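/- Let $\pi$ be a (possibly empty) set of prime numbers, let $N$ be a torsion-free nilpotent group of finite (Prüfer) rank, and let $\sigma$ be an injective endomorphism of $N$. Then the following are equivalent. 1. $\sigma$ is $\pi$-like. 2. For every finite central series $1=N_0\leqslant N_1\leqslant\cdots\leqslant N_r=N$ of $N$ (that is, $[N_{i},N]\leqslant N_{i-1}$ for $1\leqslant i\leqslant r$) which is preserved by $\sigma$ ($\sigma(N_i)\leqslant N_i$ for all $i$) and has torsion-free sections $N_i/N_{i-1}$, the endomorphism induced by $\sigma$ on each section $N_i/N_{i-1}$ is $\pi$-like. 3. The endomorphism induced by $\sigma$ on $N/\Gamma_2(N)$ is $\pi$-like. Here $\Gamma_2(N)$ is the preimage in $N$ of the torsion subgroup of $N/[N,N]$. Let $\mathbb{Z}[1/\pi]\subseteq\mathbb{Q}$ be the ring of fractions $m/n$ with $m,n\in\mathbb{Z}$, $n\neq 0$ and all prime divisors of $n$ in $\pi$. An automorphism $\nu$ of a finite-dimensional rational vector space is called $\pi$-like if the coefficients of its characteristic polynomial lie in $\mathbb{Z}[1/\pi]$. An endomorphism of a torsion-free nilpotent group $G$ of finite rank is called $\pi$-like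 if it induces a $\pi$-like automorphism of the rational Lie algebra $\log R$ associated with $G$, where $R$ is the Mal'cev completion of $G$ (for $G$ abelian this is $\mathbb{Q}\otimes G$). Concretely, $\log R$ is the Lie algebra over $\mathbb{Q}$ generated by the logarithms $\log g$, $g\in G$, in the completion of $\mathbb{Q}[G]$ at its augmentation ideal, and the induced map sends $\log g$ to the logarithm of the image of $g$. -/

import Mathlib

noncomputable section

namespace PiLike

/-! ### Group-theoretic notions -/

/-- A group is torsion-free if `1` is its only element of finite order. -/
def TorsionFree (G : Type*) [Group G] : Prop :=
  ∀ g : G, IsOfFinOrder g → g = 1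

/-- A group has finite (Prüfer) rank if there is a bound `r` such that every finitely generated
subgroup can be generated by at most `r` elements. -/
def FiniteRank (G : Type*) [Group G] : Prop :=
  ∃ r : ℕ, ∀ H : Subgroup G, H.FG →
    ∃ S : Finset G, S.card ≤ r ∧ Subgroup.closure (S : Set G) = H

/-- `Γ₂(G)`, the isolator of the derived subgroup: the preimage in `G` of the torsion subgroup of
`G/G'`. -/
def isolatedDerived (G : Type*) [Group G] : Subgroup G :=
  (CommGroup.torsion (Abelianization G)).comap Abelianization.of

instance isolatedDerived_normal (G : Type*) [Group G] : (isolatedDerived G).Normal :=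
  inferInstanceAs ((CommGroup.torsion (Abelianization G)).comap Abelianization.of).Normal

theorem isolatedDerived_le_comap {G : Type*} [Group G] (σ : G →* G) :
    isolatedDerived G ≤ (isolatedDerived G).comap σ := by
  intro x hx
  have hx' : IsOfFinOrder (Abelianization.of x) := hx
  exact (Abelianization.map σ).isOfFinOrder hx'

/-- The endomorphism of the torsion-free abelianisation `G/Γ₂(G)` induced by `σ`. -/
def abelianisationMap {G : Type*} [Group G] (σ : G →* G) :
    G ⧸ isolatedDerived G →* G ⧸ isolatedDerived G :=
  QuotientGroup.map _ _ σ (isolatedDerived_le_comap σ)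

/-- A (finite) central series `1 = H 0 ≤ H 1 ≤ ⋯ ≤ H r = G` that is preserved by `σ`, that is
`σ (H i) ≤ H i` for all `i`, and has torsion-free sections `H (i + 1) / H i`. The series is indexed
by `ℕ`; all its terms from the index `length` on are equal to `G`. -/
structure InvariantCentralSeries {G : Type*} [Group G] (σ : G →* G) where
  /-- the terms of the series -/
  H : ℕ → Subgroup G
  /-- the length of the series -/
  length : ℕ
  mono : Monotone H
  bot : H 0 = ⊥
  top : H length = ⊤
  central : ∀ i, ⁅H (i + 1), (⊤ : Subgroup G)⁆ ≤ H i
  preserved : ∀ i, (H i).map σ ≤ H i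
  torsionFree : ∀ i, ∀ x ∈ H (i + 1), ∀ n : ℕ, 0 < n → x ^ n ∈ H i → x ∈ H i

namespace InvariantCentralSeries

variable {G : Type*} [Group G] {σ : G →* G} (S : InvariantCentralSeries σ)

instance normal (i : ℕ) : (S.H i).Normal := by
  refine ⟨fun x hx g => ?_⟩
  have h : x * g * x⁻¹ * g⁻¹ ∈ S.H i :=
    S.central i (Subgroup.commutator_mem_commutator (S.mono (Nat.le_succ i) hx)
      (Subgroup.mem_top g))
  have h2 : g * x * g⁻¹ = (x * g * x⁻¹ * g⁻¹)⁻¹ * x := by group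
  rw [h2]
  exact mul_mem (inv_mem h) hx

/-- The section `H (i + 1) / H i`. -/
abbrev Sec (i : ℕ) : Type _ := S.H (i + 1) ⧸ (S.H i).subgroupOf (S.H (i + 1))

/-- The restriction of `σ` to a term of the series. -/
def restrict (i : ℕ) : S.H i →* S.H i :=
  (σ.comp (S.H i).subtype).codRestrict (S.H i)
    fun x => S.preserved i (Subgroup.mem_map_of_mem σ x.2)

/-- The action of `σ` on the section `H (i + 1) / H i`. -/
def secMap (i : ℕ) : S.Sec i →* S.Sec i :=
  QuotientGroup.map _ _ (S.restrict (i + 1))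
    fun x hx => S.preserved i (Subgroup.mem_map_of_mem σ (show (x : G) ∈ S.H i from hx))

end InvariantCentralSeries

/-! ### The rational Lie algebra of a group

For a torsion-free nilpotent group `G` of finite rank, the Mal'cev completion `R` of `G` consists of
the rational powers of the elements of `G` inside the unit group of the completion of the rational
group algebra `ℚ[G]` at its augmentation ideal `I`, and the rational Lie algebra associated with `G`
is `log R`, with the commutator bracket `[a, b] = ab - ba`. As every element of `R` has a positive
power in `G`, this is also the Lie algebra generated over `ℚ` by the elements `log g`, `g ∈ G`.
-/

/-- The augmentation `ℚ[G] → ℚ`, sending each `g ∈ G` to `1`. -/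
def augmentation (G : Type*) [Group G] : MonoidAlgebra ℚ G →ₐ[ℚ] ℚ :=
  MonoidAlgebra.lift ℚ ℚ G 1

/-- The augmentation ideal of `ℚ[G]`. -/
def augIdeal (G : Type*) [Group G] : Ideal (MonoidAlgebra ℚ G) :=
  RingHom.ker (augmentation G)

instance augIdeal_isTwoSided (G : Type*) [Group G] : (augIdeal G).IsTwoSided :=
  inferInstanceAs (RingHom.ker (augmentation G)).IsTwoSided

/-- The product `∏ₙ ℚ[G]/Iⁿ`, which contains the `I`-adic completion `lim ℚ[G]/Iⁿ` as the
subalgebra of compatible sequences. -/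
abbrev ProQuot (G : Type*) [Group G] : Type _ :=
  ∀ n : ℕ, MonoidAlgebra ℚ G ⧸ (augIdeal G ^ n)

/-- The Lie bracket on `∏ₙ ℚ[G]/Iⁿ` is the ring commutator `[a, b] = ab - ba`. -/
instance proQuotLieRing (G : Type*) [Group G] : LieRing (ProQuot G) :=
  LieRing.ofAssociativeRing

instance proQuotLieAlgebra (G : Type*) [Group G] : LieAlgebra ℚ (ProQuot G) :=
  letI := LieRing.ofAssociativeRing (A := ProQuot G)
  LieAlgebra.ofAssociativeAlgebra

/-- `log g = ∑_{k ≥ 0} (-1)ᵏ (g - 1)ᵏ⁺¹ / (k + 1)` in the `I`-adic completion of `ℚ[G]`; modulo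
`Iⁿ` only the terms with `k < n` matter. -/
def log {G : Type*} [Group G] (g : G) : ProQuot G := fun n =>
  Ideal.Quotient.mkₐ ℚ (augIdeal G ^ n)
    (∑ k ∈ Finset.range n,
      ((-1 : ℚ) ^ k / ((k : ℚ) + 1)) • (MonoidAlgebra.of ℚ G g - 1) ^ (k + 1))

/-- The rational Lie algebra associated with `G`, generated by the logarithms of the elements
of `G`. -/
def malcevLie (G : Type*) [Group G] : LieSubalgebra ℚ (ProQuot G) :=
  LieSubalgebra.lieSpan ℚ (ProQuot G) (Set.range log)

section Functoriality

variable {G : Type*} [Group G]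

/-- The endomorphism of the group algebra induced by `σ`. -/
def algMap (σ : G →* G) : MonoidAlgebra ℚ G →ₐ[ℚ] MonoidAlgebra ℚ G :=
  MonoidAlgebra.mapDomainAlgHom ℚ ℚ σ

theorem augmentation_algMap (σ : G →* G) (x : MonoidAlgebra ℚ G) :
    augmentation G (algMap σ x) = augmentation G x := by
  have h : (augmentation G).comp (algMap σ) = augmentation G := by
    apply (MonoidAlgebra.lift ℚ ℚ G).symm.injective
    ext x
    simp [augmentation, algMap]
  exact DFunLike.congr_fun h x

theorem augIdeal_pow_le_comap (σ : G →* G) (n : ℕ) :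
    augIdeal G ^ n ≤ (augIdeal G ^ n).comap (algMap σ) := by
  induction n with
  | zero =>
    intro x _
    rw [Ideal.mem_comap, Submodule.pow_zero, Ideal.one_eq_top]
    exact Submodule.mem_top
  | succ n ih =>
    rw [Submodule.pow_succ]
    refine Ideal.mul_le.2 fun r hr s hs => ?_
    rw [Ideal.mem_comap, map_mul]
    refine Ideal.mul_mem_mul (ih hr) ?_
    exact (augmentation_algMap σ s).trans hs

/-- The endomorphism of `∏ₙ ℚ[G]/Iⁿ` induced by `σ`. -/
def proMap (σ : G →* G) : ProQuot G →ₐ[ℚ] ProQuot G :=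
  AlgHom.pi fun n =>
    (Ideal.quotientMapₐ (augIdeal G ^ n) (algMap σ) (augIdeal_pow_le_comap σ n)).comp
      (Pi.evalAlgHom ℚ _ n)

theorem proMap_log (σ : G →* G) (g : G) : proMap σ (log g) = log (σ g) := by
  funext n
  have : algMap σ (∑ k ∈ Finset.range n,
      ((-1 : ℚ) ^ k / ((k : ℚ) + 1)) • (MonoidAlgebra.of ℚ G g - 1) ^ (k + 1)) =
      ∑ k ∈ Finset.range n,
      ((-1 : ℚ) ^ k / ((k : ℚ) + 1)) • (MonoidAlgebra.of ℚ G (σ g) - 1) ^ (k + 1) := by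
    have h : algMap σ (MonoidAlgebra.of ℚ G g) = MonoidAlgebra.of ℚ G (σ g) := by
      simp [algMap]
    simp only [map_sum, map_smul, map_pow, map_sub, map_one, h]
  exact congrArg (Ideal.Quotient.mkₐ ℚ (augIdeal G ^ n)) this

theorem proMap_mem (σ : G →* G) (x : ProQuot G) (hx : x ∈ malcevLie G) :
    proMap σ x ∈ malcevLie G := by
  let f : ProQuot G →ₗ⁅ℚ⁆ ProQuot G :=
    { (proMap σ).toLinearMap with
      map_lie' := fun {a b} => by
        change proMap σ (a * b - b * a) =
          proMap σ a * proMap σ b - proMap σ b * proMap σ a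
        simp only [map_sub, map_mul] }
  have h : malcevLie G ≤ (malcevLie G).comap f := by
    refine LieSubalgebra.lieSpan_le.2 ?_
    rintro _ ⟨g, rfl⟩
    change proMap σ (log g) ∈ malcevLie G
    rw [proMap_log]
    exact LieSubalgebra.subset_lieSpan ⟨σ g, rfl⟩
  exact h hx

/-- The linear endomorphism of the rational Lie algebra of `G` induced by `σ`; it sends `log g` to
`log (σ g)`. -/
def malcevMap (σ : G →* G) : malcevLie G →ₗ[ℚ] malcevLie G :=
  LinearMap.restrict (p := (malcevLie G).toSubmodule) (q := (malcevLie G).toSubmodule)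
    (proMap σ).toLinearMap (proMap_mem σ)

end Functoriality

/-! ### `π`-like maps -/

/-- A `π`-number is an integer all of whose prime divisors lie in `π`. -/
def IsPiNumber (π : Set Nat.Primes) (n : ℤ) : Prop :=
  ∀ p : Nat.Primes, ((p : ℕ) : ℤ) ∣ n → p ∈ π

/-- `ℤ[1/π]`, the set of the fractions `m / n` with `n` a non-zero `π`-number. -/
def zInvPi (π : Set Nat.Primes) : Set ℚ :=
  {q | ∃ m n : ℤ, n ≠ 0 ∧ IsPiNumber π n ∧ q = (m : ℚ) / (n : ℚ)}

/-- A linear endomorphism `ν` of a finite-dimensional rational vector space is a `π`-like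
automorphism if it is bijective and the coefficients of its characteristic polynomial lie in
`ℤ[1/π]`. -/
def IsPiLikeAut (π : Set Nat.Primes) {V : Type*} [AddCommGroup V] [Module ℚ V]
    [FiniteDimensional ℚ V] (ν : V →ₗ[ℚ] V) : Prop :=
  Function.Bijective ν ∧ ∀ k : ℕ, ν.charpoly.coeff k ∈ zInvPi π

/-- An endomorphism of a group is `π`-like if it induces a `π`-like automorphism of the associated
rational Lie algebra (which is required to be finite-dimensional, as it is for every torsion-free
nilpotent group of finite rank). -/
def IsPiLike (π : Set Nat.Primes) {G : Type*} [Group G] (σ : G →* G) : Prop :=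
  ∃ _ : FiniteDimensional ℚ (malcevLie G), IsPiLikeAut π (malcevMap σ)

end PiLike

end

/-!
Write `V(G)` for the rational Lie algebra `malcevLie G`, and `I` for the augmentation ideal of the
rational group algebra `ℚ[N]`.

*`π`-integrality.* By Cayley-Hamilton, and because `ℤ[1/π]` is integrally closed, a linear
endomorphism of a finite-dimensional space is a `π`-like automorphism if and only if it is
annihilated by a monic polynomial over `ℤ[1/π]` with non-zero constant coefficient
(`isPiLikeAut_iff`). In this form the property visibly passes to equivariant quotients
(`IsPiIntegral.of_surjective`), to tensor products (`IsPiIntegral.tensorMap`) and to extensions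
(`piPolynomial_mul`), and the argument needs nothing else about it.

*The Lie algebra of a nilpotent group.* As `[log g, log h] = log (Ad g) (log h)`, the Lie algebra
`V(N)` is the linear span of the logarithms (`mem_malcevLie`). So the linear extension of the
logarithm is a surjection `ℚ[N] → V(N)` (`logLie`). It vanishes on `Iᶜ⁺¹`, where `c` is the nilpotency
class (`logHom_eq_zero`): on products of elements `g - 1`, graded by weight in the lower central
series, the squaring map `g ↦ g ^ 2` acts by `2 ^ j`, up to terms that are already known to vanish,
where `j` is the number of factors, while `log (g ^ 2) = 2 log g`. Hence only single factors can
contribute, and in weights above `c` there are none. For a torsion-free abelian group the logarithm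
is an additive injection (`lieLog_mul`, `lieLog_eq_zero_iff`), so that `V` is the rationalization.

*The equivalences.* The condition on the torsion-free abelianisation `N/Γ₂(N)` is compared with each of
the other two.

* `V(N/Γ₂(N))` is an equivariant quotient of `V(N)` (`isPiLike_abelianisationMap_of_isPiLike`).
* Conversely, `V(N/Γ₂(N))` is isomorphic to `I/I²`, and its tensor powers map onto the quotients
  `Iᵏ/Iᵏ⁺¹`. Therefore `V(N)`, the image of `I/Iᶜ⁺¹`, is filtered with `π`-integral factors
  (`isPiLike_of_abelianisationMap`).
* The isolated lower central series is an invariant central series with torsion-free sections,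
  and its top section is `N/Γ₂(N)` (`isPiLike_abelianisationMap_of_isoSeries`).
* Each section of the isolated lower central series is, through commutators, an equivariant quotient
  of the tensor product of the section above it with `N/Γ₂(N)`, after rationalization. So the sections
  of this series are `π`-integral if `N/Γ₂(N)` is (`isPiIntegral_isoSeries`). A Schreier-type
  argument transfers this to every other invariant series (`isPiIntegral_secMap_of_forall`), whose
  sections are finite-dimensional after rationalization because `N` has finite rank
  (`finite_of_finiteRank`).
-/

noncomputable section

namespace PiLike

open Polynomial TensorProduct
open scoped commutatorElement

/-! ### The logarithm of a product of commuting unipotent elements -/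

/-- The binomial coefficient `X (X - 1) ⋯ (X - k + 1) / k!` as a rational polynomial. -/
def binomPoly (k : ℕ) : ℚ[X] := C ((k.factorial : ℚ)⁻¹) * descPochhammer ℚ k

theorem eval_binomPoly (k m : ℕ) : (binomPoly k).eval (m : ℚ) = (m.choose k : ℚ) := by
  rw [binomPoly, eval_mul, eval_C, descPochhammer_eval_eq_descFactorial,
    Nat.descFactorial_eq_factorial_mul_choose]
  push_cast
  field_simp

theorem coeff_zero_descPochhammer_succ (k : ℕ) : (descPochhammer ℚ (k + 1)).coeff 0 = 0 := by
  rw [descPochhammer_succ_left, coeff_X_mul_zero]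

theorem coeff_one_descPochhammer_succ (k : ℕ) :
    (descPochhammer ℚ (k + 1)).coeff 1 = (-1) ^ k * k.factorial := by
  induction k with
  | zero => simp
  | succ k ih =>
    rw [descPochhammer_succ_right, mul_sub, coeff_sub, coeff_mul_X, coeff_zero_descPochhammer_succ,
      ← C_eq_natCast, coeff_mul_C, ih, Nat.factorial_succ]
    push_cast
    ring

theorem binomPoly_zero : binomPoly 0 = 1 := by simp [binomPoly]

theorem coeff_zero_binomPoly_succ (k : ℕ) : (binomPoly (k + 1)).coeff 0 = 0 := by
  rw [binomPoly, coeff_C_mul, coeff_zero_descPochhammer_succ, mul_zero]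

/-- The coefficients of the logarithmic series are the linear coefficients of the binomial
polynomials. -/
theorem coeff_one_binomPoly_succ (k : ℕ) :
    (binomPoly (k + 1)).coeff 1 = (-1) ^ k / ((k : ℚ) + 1) := by
  rw [binomPoly, coeff_C_mul, coeff_one_descPochhammer_succ, Nat.factorial_succ]
  push_cast
  field_simp

/-- The logarithmic series of `a`, truncated after the term `(a - 1) ^ n`. -/
def truncLog {R : Type*} [Ring R] [Algebra ℚ R] (n : ℕ) (a : R) : R :=
  ∑ k ∈ Finset.range n, ((-1 : ℚ) ^ k / ((k : ℚ) + 1)) • (a - 1) ^ (k + 1)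

/-- A vector-valued polynomial function that vanishes at all natural numbers has vanishing
linear coefficient. -/
theorem sum_coeff_one_smul_eq_zero {ι M : Type*} [AddCommGroup M] [Module ℚ M] (s : Finset ι)
    (f : ι → ℚ[X]) (r : ι → M) (h : ∀ m : ℕ, ∑ i ∈ s, (f i).eval (m : ℚ) • r i = 0) :
    ∑ i ∈ s, (f i).coeff 1 • r i = 0 := by
  rw [← Module.forall_dual_apply_eq_zero_iff ℚ]
  intro φ
  have hp : ∑ i ∈ s, f i * C (φ (r i)) = 0 := by
    apply Polynomial.eq_zero_of_infinite_isRoot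
    refine Set.Infinite.mono ?_ (Set.infinite_range_of_injective (Nat.cast_injective (R := ℚ)))
    rintro _ ⟨m, rfl⟩
    have := congrArg φ (h m)
    simpa [IsRoot, eval_finsetSum] using this
  have := congrArg (fun p => coeff p 1) hp
  simpa [finsetSum_coeff] using this

theorem truncLog_eq_sum {R : Type*} [Ring R] [Algebra ℚ R] (n : ℕ) (a : R) (ha : (a - 1) ^ n = 0) :
    truncLog n a = ∑ k ∈ Finset.range n, (binomPoly k).coeff 1 • (a - 1) ^ k := by
  have h := Finset.sum_range_succ' (fun k => (binomPoly k).coeff 1 • (a - 1) ^ k) n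
  rw [Finset.sum_range_succ, ha, smul_zero, add_zero] at h
  rw [h, truncLog, binomPoly_zero]
  simp [coeff_one_binomPoly_succ, coeff_one]

theorem pow_eq_sum_binomPoly {R : Type*} [Ring R] [Algebra ℚ R] (n : ℕ) (a : R)
    (ha : (a - 1) ^ n = 0) (m : ℕ) :
    a ^ m = ∑ k ∈ Finset.range n, (binomPoly k).eval (m : ℚ) • (a - 1) ^ k := by
  have h1 : a ^ m = ∑ k ∈ Finset.range (m + 1), (binomPoly k).eval (m : ℚ) • (a - 1) ^ k := by
    have := (Commute.one_right (a - 1)).add_pow m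
    rw [sub_add_cancel] at this
    rw [this]
    refine Finset.sum_congr rfl fun k _ => ?_
    rw [eval_binomPoly, one_pow, mul_one, Nat.cast_smul_eq_nsmul, nsmul_eq_mul, Nat.cast_comm]
  rw [h1]
  rcases le_total n (m + 1) with hn | hn
  · symm
    refine Finset.sum_subset (Finset.range_mono hn) fun k _ hk => ?_
    rw [pow_eq_zero_of_le (by simpa using hk) ha, smul_zero]
  · refine Finset.sum_subset (Finset.range_mono hn) fun k _ hk => ?_
    rw [eval_binomPoly, Nat.choose_eq_zero_of_lt (by simpa using hk), Nat.cast_zero, zero_smul]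

/-- The truncated logarithm turns products of commuting unipotent elements into sums: `log a` is the
linear coefficient of the polynomial function `m ↦ a ^ m`. -/
theorem truncLog_mul {R : Type*} [Ring R] [Algebra ℚ R] (n : ℕ) {a b : R} (hab : Commute a b)
    (ha : (a - 1) ^ n = 0) (hb : (b - 1) ^ n = 0) (hc : (a * b - 1) ^ n = 0) :
    truncLog n (a * b) = truncLog n a + truncLog n b := by
  rcases Nat.eq_zero_or_pos n with rfl | hn
  · simp [truncLog]
  let s := Finset.range n
  let f : ℕ ⊕ (ℕ × ℕ) → ℚ[X] := Sum.elim binomPoly fun p => binomPoly p.1 * binomPoly p.2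
  let r : ℕ ⊕ (ℕ × ℕ) → R := Sum.elim (fun k => (a * b - 1) ^ k)
    fun p => -((a - 1) ^ p.1 * (b - 1) ^ p.2)
  have key := sum_coeff_one_smul_eq_zero (s.disjSum (s ×ˢ s)) f r (by
    intro m
    rw [Finset.sum_disjSum]
    have h1 := hab.mul_pow m
    rw [pow_eq_sum_binomPoly n _ ha, pow_eq_sum_binomPoly n _ hb, pow_eq_sum_binomPoly n _ hc,
      Finset.sum_mul_sum, ← Finset.sum_product'] at h1
    simp only [f, r, Sum.elim_inl, Sum.elim_inr, s]
    rw [h1, ← Finset.sum_add_distrib]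
    refine Finset.sum_eq_zero fun p _ => ?_
    rw [smul_mul_smul_comm, eval_mul, smul_neg, add_neg_cancel])
  rw [Finset.sum_disjSum] at key
  simp only [f, r, Sum.elim_inl, Sum.elim_inr, s, ← truncLog_eq_sum n _ hc] at key
  rw [eq_neg_of_add_eq_zero_left key, truncLog_eq_sum n _ ha, truncLog_eq_sum n _ hb,
    Finset.sum_product, ← Finset.sum_neg_distrib]
  simp only [smul_neg, Finset.sum_neg_distrib, neg_neg]
  obtain ⟨n, rfl⟩ := Nat.exists_eq_succ_of_ne_zero hn.ne'
  have h0 : ∀ k, (binomPoly k).coeff 0 = if k = 0 then 1 else 0 := by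
    rintro (_ | k)
    · simp [binomPoly_zero]
    · simp [coeff_zero_binomPoly_succ]
  have h1 : ∀ i j, (binomPoly i * binomPoly j).coeff 1 =
      (if i = 0 then (binomPoly j).coeff 1 else 0) + if j = 0 then (binomPoly i).coeff 1 else 0 := by
    intro i j
    rw [coeff_mul, Finset.Nat.antidiagonal_succ]
    simp [h0]
  simp only [h1, add_smul, Finset.sum_add_distrib, ite_smul, zero_smul]
  rw [add_comm]
  simp

/-! ### Linear maps on the group algebra and the augmentation filtration -/

section GroupAlgebra

variable {G : Type*} [Group G]

/-- The linear extension of a function on `G` to the group algebra. -/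
def linExt {M : Type*} [AddCommGroup M] [Module ℚ M] (f : G → M) : MonoidAlgebra ℚ G →ₗ[ℚ] M :=
  (Finsupp.linearCombination ℚ f).comp (MonoidAlgebra.coeffLinearEquiv ℚ).toLinearMap

@[simp]
theorem linExt_of {M : Type*} [AddCommGroup M] [Module ℚ M] (f : G → M) (g : G) :
    linExt f (MonoidAlgebra.of ℚ G g) = f g := by
  simp [linExt, MonoidAlgebra.of_apply]

theorem linearMap_ext_of {M : Type*} [AddCommGroup M] [Module ℚ M]
    {φ ψ : MonoidAlgebra ℚ G →ₗ[ℚ] M}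
    (h : ∀ g, φ (MonoidAlgebra.of ℚ G g) = ψ (MonoidAlgebra.of ℚ G g)) : φ = ψ := by
  refine MonoidAlgebra.lhom_ext' fun g => LinearMap.ext_ring ?_
  simpa [MonoidAlgebra.of_apply] using h g

@[simp]
theorem augmentation_of (g : G) : augmentation G (MonoidAlgebra.of ℚ G g) = 1 := by
  simp [augmentation]

theorem mem_augIdeal {x : MonoidAlgebra ℚ G} : x ∈ augIdeal G ↔ augmentation G x = 0 := Iff.rfl

theorem of_sub_one_mem_augIdeal (g : G) : MonoidAlgebra.of ℚ G g - 1 ∈ augIdeal G := by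
  rw [mem_augIdeal, map_sub, augmentation_of, map_one, sub_self]

theorem linExt_of_sub_one (x : MonoidAlgebra ℚ G) :
    linExt (fun g => MonoidAlgebra.of ℚ G g - 1) x
      = x - algebraMap ℚ _ (augmentation G x) := by
  have : linExt (fun g : G => MonoidAlgebra.of ℚ G g - 1) =
      LinearMap.id - (Algebra.linearMap ℚ _).comp (augmentation G).toLinearMap := by
    apply linearMap_ext_of
    intro g
    rw [linExt_of]
    simp only [LinearMap.sub_apply, LinearMap.id_apply, LinearMap.comp_apply, AlgHom.toLinearMap_apply,
      augmentation_of, map_one, Algebra.linearMap_apply]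
  rw [this]
  rfl

/-- The augmentation ideal is spanned by the elements `g - 1`. -/
theorem augIdeal_le_of_forall_of_sub_one_mem (K : Submodule ℚ (MonoidAlgebra ℚ G))
    (h : ∀ g : G, MonoidAlgebra.of ℚ G g - 1 ∈ K) {x : MonoidAlgebra ℚ G} (hx : x ∈ augIdeal G) :
    x ∈ K := by
  have h1 := linExt_of_sub_one x
  rw [mem_augIdeal.1 hx, map_zero, sub_zero] at h1
  rw [← h1]
  have h2 : linExt (fun g : G => K.mkQ (MonoidAlgebra.of ℚ G g - 1)) =
      K.mkQ.comp (linExt fun g => MonoidAlgebra.of ℚ G g - 1) := by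
    apply linearMap_ext_of
    intro g
    rw [LinearMap.comp_apply, linExt_of, linExt_of]
  have h3 : linExt (fun g : G => K.mkQ (MonoidAlgebra.of ℚ G g - 1)) = 0 := by
    apply linearMap_ext_of
    intro g
    rw [linExt_of, LinearMap.zero_apply]
    exact (Submodule.Quotient.mk_eq_zero K).2 (h g)
  rw [← Submodule.Quotient.mk_eq_zero K]
  exact (LinearMap.congr_fun (h2.symm.trans h3) x)

/-- `Iⁿ⁺¹` is spanned by the products `y (g - 1)` with `y ∈ Iⁿ`. -/
theorem augIdeal_pow_succ_le (K : Submodule ℚ (MonoidAlgebra ℚ G)) (n : ℕ)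
    (h : ∀ y ∈ augIdeal G ^ n, ∀ g : G, y * (MonoidAlgebra.of ℚ G g - 1) ∈ K)
    {x : MonoidAlgebra ℚ G} (hx : x ∈ augIdeal G ^ (n + 1)) : x ∈ K := by
  rw [Submodule.pow_succ] at hx
  refine Submodule.mul_induction_on hx (fun y hy z hz => ?_) fun y z hy hz => K.add_mem hy hz
  exact augIdeal_le_of_forall_of_sub_one_mem (K.comap (LinearMap.mulLeft ℚ y)) (fun g => h y hy g) hz

theorem mul_mem_augIdeal_pow {x y : MonoidAlgebra ℚ G} {m n : ℕ} (hx : x ∈ augIdeal G ^ m)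
    (hy : y ∈ augIdeal G ^ n) : x * y ∈ augIdeal G ^ (m + n) := by
  rw [Ideal.IsTwoSided.pow_add]
  exact Ideal.mul_mem_mul hx hy

theorem augIdeal_pow_le {m n : ℕ} (h : m ≤ n) : augIdeal G ^ n ≤ augIdeal G ^ m :=
  Ideal.pow_le_pow_right h

theorem pow_zero_mem (x : MonoidAlgebra ℚ G) : x ∈ augIdeal G ^ 0 := by
  rw [Submodule.pow_zero, Ideal.one_eq_top]
  exact Submodule.mem_top

/-- The convolution of two linear endomorphisms of the group algebra with respect to the coproduct
for which the group elements are group-like. -/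
def conv (f f' : MonoidAlgebra ℚ G →ₗ[ℚ] MonoidAlgebra ℚ G) :
    MonoidAlgebra ℚ G →ₗ[ℚ] MonoidAlgebra ℚ G :=
  linExt fun g => f (MonoidAlgebra.of ℚ G g) * f' (MonoidAlgebra.of ℚ G g)

theorem conv_mul_of_sub_one (f f' : MonoidAlgebra ℚ G →ₗ[ℚ] MonoidAlgebra ℚ G) (g : G)
    (y : MonoidAlgebra ℚ G) :
    conv f f' (y * (MonoidAlgebra.of ℚ G g - 1)) =
      conv (f.comp (LinearMap.mulRight ℚ (MonoidAlgebra.of ℚ G g - 1))) f' y +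
      conv f (f'.comp (LinearMap.mulRight ℚ (MonoidAlgebra.of ℚ G g - 1))) y +
      conv (f.comp (LinearMap.mulRight ℚ (MonoidAlgebra.of ℚ G g - 1)))
        (f'.comp (LinearMap.mulRight ℚ (MonoidAlgebra.of ℚ G g - 1))) y := by
  have : (conv f f').comp (LinearMap.mulRight ℚ (MonoidAlgebra.of ℚ G g - 1)) =
      conv (f.comp (LinearMap.mulRight ℚ (MonoidAlgebra.of ℚ G g - 1))) f' +
      conv f (f'.comp (LinearMap.mulRight ℚ (MonoidAlgebra.of ℚ G g - 1))) +
      conv (f.comp (LinearMap.mulRight ℚ (MonoidAlgebra.of ℚ G g - 1)))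
        (f'.comp (LinearMap.mulRight ℚ (MonoidAlgebra.of ℚ G g - 1))) := by
    apply linearMap_ext_of
    intro h
    simp only [LinearMap.comp_apply, LinearMap.add_apply, LinearMap.mulRight_apply, conv, linExt_of,
      mul_sub, mul_one, ← map_mul, map_sub]
    noncomm_ring
  exact LinearMap.congr_fun this y

/-- Convolution adds the amounts by which linear maps shift the augmentation filtration. -/
theorem conv_mem_augIdeal_pow (n : ℕ) : ∀ (s s' : ℕ)
    (f f' : MonoidAlgebra ℚ G →ₗ[ℚ] MonoidAlgebra ℚ G)
    (_ : ∀ m, ∀ x ∈ augIdeal G ^ m, f x ∈ augIdeal G ^ (m + s))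
    (_ : ∀ m, ∀ x ∈ augIdeal G ^ m, f' x ∈ augIdeal G ^ (m + s')),
    ∀ x ∈ augIdeal G ^ n, conv f f' x ∈ augIdeal G ^ (n + s + s') := by
  induction n with
  | zero =>
    intro s s' f f' hf hf' x _
    let K : Submodule ℚ (MonoidAlgebra ℚ G) := (augIdeal G ^ (0 + s + s')).restrictScalars ℚ
    have : K.mkQ.comp (conv f f') = 0 := by
      apply linearMap_ext_of
      intro g
      rw [LinearMap.comp_apply, LinearMap.zero_apply, conv, linExt_of]
      refine (Submodule.Quotient.mk_eq_zero K).2 ?_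
      have h1 := hf 0 _ (pow_zero_mem (MonoidAlgebra.of ℚ G g))
      have h2 := hf' 0 _ (pow_zero_mem (MonoidAlgebra.of ℚ G g))
      have h3 := mul_mem_augIdeal_pow h1 h2
      have : 0 + s + (0 + s') = 0 + s + s' := by omega
      rwa [this] at h3
    exact (Submodule.Quotient.mk_eq_zero K).1 (LinearMap.congr_fun this x)
  | succ n ih =>
    intro s s' f f' hf hf' x hx
    let K : Submodule ℚ (MonoidAlgebra ℚ G) :=
      ((augIdeal G ^ (n + 1 + s + s')).restrictScalars ℚ).comap (conv f f')
    refine augIdeal_pow_succ_le K n (fun y hy g => ?_) hx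
    change conv f f' _ ∈ augIdeal G ^ (n + 1 + s + s')
    rw [conv_mul_of_sub_one]
    have hR : ∀ m, ∀ z ∈ augIdeal G ^ m, LinearMap.mulRight ℚ (MonoidAlgebra.of ℚ G g - 1) z ∈
        augIdeal G ^ (m + 1) := fun m z hz => by
      rw [Submodule.pow_succ]
      exact Ideal.mul_mem_mul hz (of_sub_one_mem_augIdeal g)
    have h1 : ∀ m, ∀ z ∈ augIdeal G ^ m,
        (f.comp (LinearMap.mulRight ℚ (MonoidAlgebra.of ℚ G g - 1))) z ∈
          augIdeal G ^ (m + (s + 1)) := fun m z hz => by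
      have := hf _ _ (hR m z hz)
      rwa [show m + 1 + s = m + (s + 1) by omega] at this
    have h2 : ∀ m, ∀ z ∈ augIdeal G ^ m,
        (f'.comp (LinearMap.mulRight ℚ (MonoidAlgebra.of ℚ G g - 1))) z ∈
          augIdeal G ^ (m + (s' + 1)) := fun m z hz => by
      have := hf' _ _ (hR m z hz)
      rwa [show m + 1 + s' = m + (s' + 1) by omega] at this
    refine add_mem (add_mem ?_ ?_) ?_
    · exact augIdeal_pow_le (by omega) (ih _ _ _ _ h1 hf' y hy)
    · exact augIdeal_pow_le (by omega) (ih _ _ _ _ hf h2 y hy)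
    · exact augIdeal_pow_le (by omega) (ih _ _ _ _ h1 h2 y hy)

/-- The linear extension of `g ↦ (g - 1) ^ (k + 1)` is a convolution power of that of `g ↦ g - 1`, so it
preserves the augmentation filtration. -/
theorem linExt_of_sub_one_pow_mem (k n : ℕ) {x : MonoidAlgebra ℚ G} (hx : x ∈ augIdeal G ^ n) :
    linExt (fun g => (MonoidAlgebra.of ℚ G g - 1) ^ (k + 1)) x ∈ augIdeal G ^ n := by
  have hbase : ∀ m, ∀ x ∈ augIdeal G ^ m,
      linExt (fun g => MonoidAlgebra.of ℚ G g - 1) x ∈ augIdeal G ^ (m + 0) := by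
    intro m x hx
    rw [linExt_of_sub_one]
    rcases Nat.eq_zero_or_pos m with rfl | hm
    · exact pow_zero_mem _
    · have : x ∈ augIdeal G := by
        have := augIdeal_pow_le hm hx
        rwa [Submodule.pow_one] at this
      rw [mem_augIdeal.1 this, map_zero, sub_zero]
      exact hx
  induction k generalizing n x with
  | zero => simpa using hbase n x hx
  | succ k ih =>
    have h : linExt (fun g : G => (MonoidAlgebra.of ℚ G g - 1) ^ (k + 1 + 1)) =
        conv (linExt fun g : G => (MonoidAlgebra.of ℚ G g - 1) ^ (k + 1))
          (linExt fun g => MonoidAlgebra.of ℚ G g - 1) := by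
      apply linearMap_ext_of
      intro g
      rw [conv, linExt_of, linExt_of, linExt_of, linExt_of, pow_succ]
    rw [h]
    exact conv_mem_augIdeal_pow n 0 0 _ _ (fun m x hx => ih m hx) hbase x hx

/-! ### The linear extension of the logarithm -/

/-- The linear extension of the logarithm to the group algebra. -/
def logHom (G : Type*) [Group G] : MonoidAlgebra ℚ G →ₗ[ℚ] ProQuot G := linExt log

@[simp]
theorem logHom_of (g : G) : logHom G (MonoidAlgebra.of ℚ G g) = log g := linExt_of _ _

theorem log_apply (g : G) (n : ℕ) :
    log g n = truncLog n (Ideal.Quotient.mkₐ ℚ (augIdeal G ^ n) (MonoidAlgebra.of ℚ G g)) := by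
  simp only [log, truncLog, map_sum, map_smul, map_pow, map_sub, map_one]

theorem mkₐ_of_sub_one_pow (g : G) (n : ℕ) :
    (Ideal.Quotient.mkₐ ℚ (augIdeal G ^ n) (MonoidAlgebra.of ℚ G g) - 1) ^ n = 0 := by
  rw [← map_one (Ideal.Quotient.mkₐ ℚ (augIdeal G ^ n)), ← map_sub, ← map_pow]
  exact Ideal.Quotient.eq_zero_iff_mem.2 (Ideal.pow_mem_pow (of_sub_one_mem_augIdeal g) n)

theorem log_mul_of_commute {g h : G} (hgh : Commute g h) : log (g * h) = log g + log h := by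
  funext n
  rw [Pi.add_apply, log_apply, log_apply, log_apply, map_mul, map_mul]
  refine truncLog_mul n ?_ (mkₐ_of_sub_one_pow g n) (mkₐ_of_sub_one_pow h n) ?_
  · exact ((hgh.map (MonoidAlgebra.of ℚ G)).map (Ideal.Quotient.mkₐ ℚ (augIdeal G ^ n)))
  · rw [← map_mul, ← map_mul]
    exact mkₐ_of_sub_one_pow _ n

/-- The linear extension of the logarithm is continuous for the augmentation filtration. -/
theorem logHom_apply_eq_zero {n : ℕ} {x : MonoidAlgebra ℚ G} (hx : x ∈ augIdeal G ^ n) :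
    logHom G x n = 0 := by
  have h : (LinearMap.proj n).comp (logHom G) =
      ∑ k ∈ Finset.range n, ((-1 : ℚ) ^ k / ((k : ℚ) + 1)) •
        (Ideal.Quotient.mkₐ ℚ (augIdeal G ^ n)).toLinearMap.comp
          (linExt fun g => (MonoidAlgebra.of ℚ G g - 1) ^ (k + 1)) := by
    apply linearMap_ext_of
    intro g
    simp only [LinearMap.comp_apply, LinearMap.proj_apply, logHom_of, LinearMap.sum_apply,
      LinearMap.smul_apply, linExt_of, log, map_sum, map_smul, AlgHom.toLinearMap_apply]
  have h2 := LinearMap.congr_fun h x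
  simp only [LinearMap.comp_apply, LinearMap.proj_apply, LinearMap.sum_apply,
      LinearMap.smul_apply, AlgHom.toLinearMap_apply] at h2
  rw [h2]
  refine Finset.sum_eq_zero fun k _ => ?_
  rw [Ideal.Quotient.mkₐ_eq_mk, Ideal.Quotient.eq_zero_iff_mem.2 (linExt_of_sub_one_pow_mem k n hx),
    smul_zero]

end GroupAlgebra

/-! ### Commutators and the lower central series -/

section Commutators

variable {G : Type*} [Group G]

/-- The three subgroups lemma modulo a normal subgroup. -/
theorem commutator_commutator_le_of_rotate {A B C K : Subgroup G} [K.Normal]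
    (h1 : ⁅⁅B, C⁆, A⁆ ≤ K) (h2 : ⁅⁅C, A⁆, B⁆ ≤ K) : ⁅⁅A, B⁆, C⁆ ≤ K := by
  have key : ∀ {X Y Z : Subgroup G}, ⁅⁅X, Y⁆, Z⁆ ≤ K ↔
      ⁅⁅X.map (QuotientGroup.mk' K), Y.map (QuotientGroup.mk' K)⁆,
        Z.map (QuotientGroup.mk' K)⁆ = ⊥ := by
    intro X Y Z
    rw [← Subgroup.map_commutator, ← Subgroup.map_commutator, Subgroup.map_eq_bot_iff,
      QuotientGroup.ker_mk']
  rw [key] at *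
  exact Subgroup.commutator_commutator_eq_bot_of_rotate h1 h2

/-- The terms of the lower central series of `G`, starting with `lcs G 0 = G`. -/
abbrev lcs (G : Type*) [Group G] (n : ℕ) : Subgroup G := (⊤ : Subgroup G).lowerCentralSeries n

theorem commutator_lcs_le (i j : ℕ) : ⁅lcs G i, lcs G j⁆ ≤ lcs G (i + j + 1) := by
  induction i generalizing j with
  | zero =>
    rw [Subgroup.commutator_comm, zero_add]
    exact le_rfl
  | succ i ih =>
    change ⁅⁅lcs G i, (⊤ : Subgroup G)⁆, lcs G j⁆ ≤ _
    refine commutator_commutator_le_of_rotate ?_ ?_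
    · rw [Subgroup.commutator_comm ⊤, Subgroup.commutator_comm]
      refine (ih (j + 1)).trans (le_of_eq ?_)
      congr 1
      omega
    · rw [Subgroup.commutator_comm (lcs G j)]
      refine (Subgroup.commutator_mono (ih j) le_rfl).trans (le_of_eq ?_)
      rw [show i + 1 + j + 1 = i + j + 1 + 1 by omega]
      rfl

theorem of_mul_sub_of_mul (g h : G) :
    MonoidAlgebra.of ℚ G g * MonoidAlgebra.of ℚ G h - MonoidAlgebra.of ℚ G h * MonoidAlgebra.of ℚ G g =
      (MonoidAlgebra.of ℚ G ⁅g, h⁆ - 1) * (MonoidAlgebra.of ℚ G h * MonoidAlgebra.of ℚ G g) := by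
  rw [sub_mul, one_mul, ← map_mul, ← map_mul, ← map_mul]
  congr 2
  rw [commutatorElement_def]
  group

/-- The `n`-th dimension subgroup over `ℚ`. -/
def dimSubgroup (G : Type*) [Group G] (n : ℕ) : Subgroup G where
  carrier := {g | MonoidAlgebra.of ℚ G g - 1 ∈ augIdeal G ^ n}
  one_mem' := by
    change MonoidAlgebra.of ℚ G 1 - 1 ∈ augIdeal G ^ n
    rw [map_one, sub_self]
    exact zero_mem _
  mul_mem' {a b} ha hb := by
    change MonoidAlgebra.of ℚ G (a * b) - 1 ∈ augIdeal G ^ n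
    rw [show MonoidAlgebra.of ℚ G (a * b) - 1 = MonoidAlgebra.of ℚ G a *
      (MonoidAlgebra.of ℚ G b - 1) + (MonoidAlgebra.of ℚ G a - 1) by rw [map_mul]; noncomm_ring]
    exact add_mem (Ideal.mul_mem_left _ _ hb) ha
  inv_mem' {a} ha := by
    change MonoidAlgebra.of ℚ G a⁻¹ - 1 ∈ augIdeal G ^ n
    rw [show MonoidAlgebra.of ℚ G a⁻¹ - 1 = -(MonoidAlgebra.of ℚ G a⁻¹ *
      (MonoidAlgebra.of ℚ G a - 1)) by
        rw [mul_sub, ← map_mul, inv_mul_cancel, map_one]; noncomm_ring]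
    exact neg_mem (Ideal.mul_mem_left _ _ ha)

/-- For `g` in the term `n` of the lower central series, `g - 1` lies in the power `n + 1` of the
augmentation ideal. -/
theorem lcs_le_dimSubgroup (n : ℕ) : lcs G n ≤ dimSubgroup G (n + 1) := by
  induction n with
  | zero =>
    intro g _
    change _ ∈ augIdeal G ^ (0 + 1)
    rw [zero_add, Submodule.pow_one]
    exact of_sub_one_mem_augIdeal g
  | succ n ih =>
    refine Subgroup.commutator_le.2 fun g hg h _ => ?_
    have hg' : MonoidAlgebra.of ℚ G g - 1 ∈ augIdeal G ^ (n + 1) := ih hg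
    have hh : MonoidAlgebra.of ℚ G h - 1 ∈ augIdeal G := of_sub_one_mem_augIdeal h
    change MonoidAlgebra.of ℚ G ⁅g, h⁆ - 1 ∈ augIdeal G ^ (n + 1 + 1)
    have h1 : MonoidAlgebra.of ℚ G ⁅g, h⁆ - 1 = ((MonoidAlgebra.of ℚ G g - 1) *
        (MonoidAlgebra.of ℚ G h - 1) - (MonoidAlgebra.of ℚ G h - 1) *
        (MonoidAlgebra.of ℚ G g - 1)) * (MonoidAlgebra.of ℚ G (g⁻¹ * h⁻¹)) := by
      rw [show (MonoidAlgebra.of ℚ G g - 1) * (MonoidAlgebra.of ℚ G h - 1) -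
        (MonoidAlgebra.of ℚ G h - 1) * (MonoidAlgebra.of ℚ G g - 1) =
        MonoidAlgebra.of ℚ G g * MonoidAlgebra.of ℚ G h -
        MonoidAlgebra.of ℚ G h * MonoidAlgebra.of ℚ G g by noncomm_ring, of_mul_sub_of_mul, mul_assoc,
        ← map_mul, ← map_mul]
      rw [show h * g * (g⁻¹ * h⁻¹) = 1 by group, map_one, mul_one]
    rw [h1]
    refine Ideal.mul_mem_right _ _ (sub_mem ?_ ?_)
    · rw [Submodule.pow_succ]
      exact Ideal.mul_mem_mul hg' hh
    · rw [Ideal.IsTwoSided.pow_succ]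
      exact Ideal.mul_mem_mul hh hg'

end Commutators

/-! ### The logarithm is a polynomial map -/

section Weights

variable {G : Type*}

/-- The weight of a list of group elements with assigned depths in the lower central series, where
an element of depth `d` (one of `lcs G d`) has weight `d + 1`. -/
def weight (l : List (G × ℕ)) : ℕ := (l.map fun p => p.2 + 1).sum

@[simp] theorem weight_nil : weight ([] : List (G × ℕ)) = 0 := rfl

@[simp] theorem weight_cons (p : G × ℕ) (l : List (G × ℕ)) :
    weight (p :: l) = p.2 + 1 + weight l := by simp [weight]

@[simp] theorem weight_append (l l' : List (G × ℕ)) : weight (l ++ l') = weight l + weight l' := by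
  simp [weight]

theorem weight_perm {l l' : List (G × ℕ)} (h : l.Perm l') : weight l = weight l' :=
  (h.map _).sum_eq

variable [Group G]

/-- The product of the elements `g - 1`, for `g` in a list of group elements with depths. -/
def subOneProd (l : List (G × ℕ)) : MonoidAlgebra ℚ G :=
  (l.map fun p => MonoidAlgebra.of ℚ G p.1 - 1).prod

/-- The depths assigned to the group elements in the list are correct. -/
def IsGraded (l : List (G × ℕ)) : Prop := ∀ p ∈ l, p.1 ∈ lcs G p.2

/-- The span of the products `(g₁ - 1) ⋯ (gᵢ - 1)` that have weight greater than `k`, or that have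
weight at least `k` and fewer than `j` factors. -/
def weightSpan (G : Type*) [Group G] (k j : ℕ) : Submodule ℚ (MonoidAlgebra ℚ G) :=
  Submodule.span ℚ {x | ∃ l : List (G × ℕ), IsGraded l ∧
    (k + 1 ≤ weight l ∨ (k ≤ weight l ∧ l.length < j)) ∧ subOneProd l = x}

@[simp] theorem subOneProd_nil : subOneProd ([] : List (G × ℕ)) = 1 := rfl

@[simp] theorem subOneProd_cons (p : G × ℕ) (l : List (G × ℕ)) :
    subOneProd (p :: l) = (MonoidAlgebra.of ℚ G p.1 - 1) * subOneProd l := by simp [subOneProd]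

@[simp] theorem subOneProd_append (l l' : List (G × ℕ)) :
    subOneProd (l ++ l') = subOneProd l * subOneProd l' := by
  simp [subOneProd]

@[simp] theorem isGraded_nil : IsGraded ([] : List (G × ℕ)) := by simp [IsGraded]

@[simp] theorem isGraded_cons {p : G × ℕ} {l : List (G × ℕ)} :
    IsGraded (p :: l) ↔ p.1 ∈ lcs G p.2 ∧ IsGraded l := by simp [IsGraded]

@[simp] theorem isGraded_append {l l' : List (G × ℕ)} :
    IsGraded (l ++ l') ↔ IsGraded l ∧ IsGraded l' := by
  simp only [IsGraded, List.mem_append, or_imp, forall_and]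

theorem subOneProd_mem_weightSpan {l : List (G × ℕ)} {k j : ℕ} (hl : IsGraded l)
    (h : k + 1 ≤ weight l ∨ (k ≤ weight l ∧ l.length < j)) : subOneProd l ∈ weightSpan G k j :=
  Submodule.subset_span ⟨l, hl, h, rfl⟩

theorem weightSpan_le {k j k' j' : ℕ} (h : k + 1 ≤ k') : weightSpan G k' j' ≤ weightSpan G k j := by
  refine Submodule.span_le.2 ?_
  rintro _ ⟨l, hl, hw, rfl⟩
  exact subOneProd_mem_weightSpan hl (by omega)

theorem subOneProd_mem_augIdeal_pow {l : List (G × ℕ)} (hl : IsGraded l) :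
    subOneProd l ∈ augIdeal G ^ weight l := by
  induction l with
  | nil => exact pow_zero_mem _
  | cons p l ih =>
    rw [isGraded_cons] at hl
    rw [subOneProd_cons, weight_cons]
    exact mul_mem_augIdeal_pow (lcs_le_dimSubgroup _ hl.1) (ih hl.2)

theorem augIdeal_pow_le_weightSpan (k : ℕ) {x : MonoidAlgebra ℚ G} (hx : x ∈ augIdeal G ^ (k + 1)) :
    x ∈ weightSpan G k 0 := by
  induction k generalizing x with
  | zero =>
    refine augIdeal_le_of_forall_of_sub_one_mem _ (fun g => ?_) (by rwa [zero_add, Submodule.pow_one] at hx)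
    have := subOneProd_mem_weightSpan (l := [(g, 0)]) (k := 0) (j := 0) (by simp) (by simp)
    simpa using this
  | succ k ih =>
    refine augIdeal_pow_succ_le _ _ (fun y hy g => ?_) hx
    have hle : weightSpan G k 0 ≤ (weightSpan G (k + 1) 0).comap
        (LinearMap.mulRight ℚ (MonoidAlgebra.of ℚ G g - 1)) := by
      refine Submodule.span_le.2 ?_
      rintro _ ⟨l, hl, hw, rfl⟩
      have := subOneProd_mem_weightSpan (l := l ++ [(g, 0)]) (k := k + 1) (j := 0)
        (by simp [hl]) (by simp at *; omega)
      simpa using this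
    exact hle (ih hy)

theorem of_sub_one_mul_mem_weightSpan {p : G × ℕ} (hp : p.1 ∈ lcs G p.2) {k j : ℕ}
    {x : MonoidAlgebra ℚ G} (hx : x ∈ weightSpan G k j) :
    (MonoidAlgebra.of ℚ G p.1 - 1) * x ∈ weightSpan G (p.2 + 1 + k) (j + 1) := by
  have hle : weightSpan G k j ≤ (weightSpan G (p.2 + 1 + k) (j + 1)).comap
      (LinearMap.mulLeft ℚ (MonoidAlgebra.of ℚ G p.1 - 1)) := by
    refine Submodule.span_le.2 ?_
    rintro _ ⟨l, hl, hw, rfl⟩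
    have := subOneProd_mem_weightSpan (l := p :: l) (k := p.2 + 1 + k) (j := j + 1)
      (by simp [hl, hp]) (by simp; omega)
    simpa using this
  exact hle hx

/-- Permuting the factors changes a product only by products that have larger weight or fewer
factors. -/
theorem subOneProd_sub_mem_of_perm {l l' : List (G × ℕ)} (h : l.Perm l') (hl : IsGraded l) :
    subOneProd l - subOneProd l' ∈ weightSpan G (weight l) l.length := by
  induction h with
  | nil => simp
  | @cons p l l' h ih =>
    rw [isGraded_cons] at hl
    rw [subOneProd_cons, subOneProd_cons, ← mul_sub, weight_cons, List.length_cons]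
    exact of_sub_one_mul_mem_weightSpan hl.1 (ih hl.2)
  | swap p q l =>
    simp only [isGraded_cons] at hl
    obtain ⟨hq, hp, hl⟩ := hl
    let c : G × ℕ := (⁅q.1, p.1⁆, q.2 + p.2 + 1)
    have hc : c.1 ∈ lcs G c.2 := commutator_lcs_le _ _ (Subgroup.commutator_mem_commutator hq hp)
    have key : subOneProd (q :: p :: l) - subOneProd (p :: q :: l) =
        subOneProd (c :: p :: q :: l) + subOneProd (c :: p :: l) + subOneProd (c :: q :: l) +
          subOneProd (c :: l) := by
      have := of_mul_sub_of_mul q.1 p.1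
      simp only [subOneProd_cons, c]
      rw [show (MonoidAlgebra.of ℚ G q.1 - 1) * ((MonoidAlgebra.of ℚ G p.1 - 1) * subOneProd l) -
        (MonoidAlgebra.of ℚ G p.1 - 1) * ((MonoidAlgebra.of ℚ G q.1 - 1) * subOneProd l) =
        (MonoidAlgebra.of ℚ G q.1 * MonoidAlgebra.of ℚ G p.1 -
          MonoidAlgebra.of ℚ G p.1 * MonoidAlgebra.of ℚ G q.1) * subOneProd l by noncomm_ring, this]
      noncomm_ring
    rw [key]
    refine add_mem (add_mem (add_mem ?_ ?_) ?_) ?_ <;>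
    · refine subOneProd_mem_weightSpan (by simp_all) ?_
      simp only [weight_cons, List.length_cons, c]
      omega
  | trans h₁ h₂ ih₁ ih₂ =>
    rename_i l₁ l₂ l₃
    have hl₂ : IsGraded l₂ := fun p hp => hl p (h₁.mem_iff.2 hp)
    have := add_mem (ih₁ hl) ((weight_perm h₁) ▸ h₁.length_eq ▸ ih₂ hl₂)
    simpa using this

/-- The linear map sending each group element `g` to `u g v g`. For `u = v = 1` it extends the
squaring map of the group. -/
def doubling (u v : MonoidAlgebra ℚ G) : MonoidAlgebra ℚ G →ₗ[ℚ] MonoidAlgebra ℚ G :=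
  linExt fun g => u * MonoidAlgebra.of ℚ G g * v * MonoidAlgebra.of ℚ G g

theorem doubling_of_sub_one_mul (u v : MonoidAlgebra ℚ G) (g : G) (y : MonoidAlgebra ℚ G) :
    doubling u v ((MonoidAlgebra.of ℚ G g - 1) * y) =
      doubling (u * (MonoidAlgebra.of ℚ G g - 1)) v y +
      doubling u (v * (MonoidAlgebra.of ℚ G g - 1)) y +
      doubling (u * (MonoidAlgebra.of ℚ G g - 1)) (v * (MonoidAlgebra.of ℚ G g - 1)) y := by
  have : (doubling u v).comp (LinearMap.mulLeft ℚ (MonoidAlgebra.of ℚ G g - 1)) =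
      doubling (u * (MonoidAlgebra.of ℚ G g - 1)) v +
      doubling u (v * (MonoidAlgebra.of ℚ G g - 1)) +
      doubling (u * (MonoidAlgebra.of ℚ G g - 1)) (v * (MonoidAlgebra.of ℚ G g - 1)) := by
    apply linearMap_ext_of
    intro h
    rw [LinearMap.comp_apply, LinearMap.mulLeft_apply, sub_mul, one_mul, ← map_mul, map_sub]
    simp only [LinearMap.add_apply, doubling, linExt_of]
    rw [map_mul]
    noncomm_ring
  exact LinearMap.congr_fun this y

/-- Up to products of larger weight or with fewer factors, the squaring map multiplies a product
with `j` factors by `2 ^ j`. -/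
theorem doubling_subOneProd (l : List (G × ℕ)) : ∀ p q : List (G × ℕ), IsGraded p → IsGraded q →
    IsGraded l → doubling (subOneProd p) (subOneProd q) (subOneProd l) -
      (2 : ℚ) ^ l.length • subOneProd (p ++ q ++ l) ∈
        weightSpan G (weight (p ++ q ++ l)) (p ++ q ++ l).length := by
  induction l with
  | nil =>
    intro p q _ _ _
    have h1 : doubling (subOneProd p) (subOneProd q) (1 : MonoidAlgebra ℚ G) =
        subOneProd p * subOneProd q := by
      rw [← map_one (MonoidAlgebra.of ℚ G), doubling, linExt_of, map_one, mul_one, mul_one]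
    simp [h1]
  | cons x l ih =>
    intro p q hp hq hl
    rw [isGraded_cons] at hl
    have hx : IsGraded [x] := by simp [hl.1]
    have e (r : List (G × ℕ)) : subOneProd r * (MonoidAlgebra.of ℚ G x.1 - 1) =
        subOneProd (r ++ [x]) := by simp
    rw [subOneProd_cons, doubling_of_sub_one_mul, e, e]
    have i1 := ih (p ++ [x]) q (isGraded_append.2 ⟨hp, hx⟩) hq hl.2
    have i2 := ih p (q ++ [x]) hp (isGraded_append.2 ⟨hq, hx⟩) hl.2
    have i3 := ih (p ++ [x]) (q ++ [x]) (isGraded_append.2 ⟨hp, hx⟩) (isGraded_append.2 ⟨hq, hx⟩) hl.2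
    have perm : (p ++ [x] ++ q ++ l).Perm (p ++ q ++ x :: l) := by
      simp only [List.append_assoc]
      refine List.Perm.append_left p ?_
      simp only [List.singleton_append]
      exact List.perm_middle.symm
    have eq2 : p ++ (q ++ [x]) ++ l = p ++ q ++ x :: l := by simp
    have i4 := subOneProd_sub_mem_of_perm perm (by
      simp only [isGraded_append]; exact ⟨⟨⟨hp, hx⟩, hq⟩, hl.2⟩)
    rw [weight_perm perm, perm.length_eq] at i1 i4
    rw [eq2] at i2
    have i5 : doubling (subOneProd (p ++ [x])) (subOneProd (q ++ [x])) (subOneProd l) ∈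
        weightSpan G (weight (p ++ q ++ x :: l)) (p ++ q ++ x :: l).length := by
      have h1 := weightSpan_le (j := (p ++ q ++ x :: l).length)
        (k := weight (p ++ q ++ x :: l)) (by simp) i3
      have h2 : subOneProd (p ++ [x] ++ (q ++ [x]) ++ l) ∈
          weightSpan G (weight (p ++ q ++ x :: l)) (p ++ q ++ x :: l).length := by
        refine subOneProd_mem_weightSpan ?_ ?_
        · simp only [isGraded_append]
          exact ⟨⟨⟨hp, hx⟩, hq, hx⟩, hl.2⟩
        · left
          simp
      have := add_mem h1 (Submodule.smul_mem _ ((2 : ℚ) ^ l.length) h2)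
      simpa using this
    have := add_mem (add_mem (add_mem i1 i2) i5) (Submodule.smul_mem _ ((2 : ℚ) ^ l.length) i4)
    convert this using 1
    rw [List.length_cons, pow_succ, mul_two, add_smul, smul_sub]
    abel

/-- `log (g ^ 2) = 2 log g`, extended linearly. -/
theorem logHom_doubling (x : MonoidAlgebra ℚ G) :
    logHom G (doubling 1 1 x) = (2 : ℚ) • logHom G x := by
  have : (logHom G).comp (doubling 1 1) = (2 : ℚ) • logHom G := by
    apply linearMap_ext_of
    intro g
    rw [LinearMap.comp_apply, LinearMap.smul_apply, doubling, linExt_of, one_mul, mul_one, ← map_mul,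
      logHom_of, logHom_of, log_mul_of_commute (Commute.refl g), two_smul]
  exact LinearMap.congr_fun this x

/-- The logarithm on a group of nilpotency class at most `c` is a polynomial map of degree at most
`c`: its linear extension vanishes on the power `c + 1` of the augmentation ideal. As
`log (g ^ 2) = 2 log g`, the logarithm can only be non-zero on products with a single factor, and
these vanish in weights exceeding `c`. -/
theorem logHom_eq_zero {c : ℕ} (hc : lcs G c = ⊥) {x : MonoidAlgebra ℚ G}
    (hx : x ∈ augIdeal G ^ (c + 1)) : logHom G x = 0 := by
  funext n
  let φ : MonoidAlgebra ℚ G →ₗ[ℚ] (MonoidAlgebra ℚ G ⧸ (augIdeal G ^ n)) :=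
    (LinearMap.proj n).comp (logHom G)
  have hφ2 : ∀ y, φ (doubling 1 1 y) = (2 : ℚ) • φ y := fun y => congrFun (logHom_doubling y) n
  have main : ∀ m k, n ≤ k + m → c ≤ k → weightSpan G k 0 ≤ LinearMap.ker φ := by
    intro m
    induction m with
    | zero =>
      intro k hk _
      refine Submodule.span_le.2 ?_
      rintro _ ⟨l, hl, hw, rfl⟩
      refine logHom_apply_eq_zero (augIdeal_pow_le ?_ (subOneProd_mem_augIdeal_pow hl))
      omega
    | succ m ih =>
      intro k hk hck
      have ih' := ih (k + 1) (by omega) (by omega)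
      have hj : ∀ j, weightSpan G (k + 1) j ≤ LinearMap.ker φ := by
        intro j
        induction j with
        | zero => exact ih'
        | succ j ihj =>
          refine Submodule.span_le.2 ?_
          rintro _ ⟨l, hl, hw, rfl⟩
          have hzero : (weight l = k + 1 ∧ l.length = j) ∨ subOneProd l ∈ weightSpan G (k + 1) j := by
            by_cases h : weight l = k + 1 ∧ l.length = j
            · exact Or.inl h
            · exact Or.inr (subOneProd_mem_weightSpan hl (by omega))
          rcases hzero with ⟨hw', hlen⟩ | h
          · match l, hl, hw', hlen with
            | [], _, hw', _ => simp at hw'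
            | [p], hl, hw', _ =>
              rw [isGraded_cons] at hl
              have h1 : p.1 ∈ lcs G c :=
                (⊤ : Subgroup G).lowerCentralSeries_antitone (by simp at hw'; omega) hl.1
              rw [hc, Subgroup.mem_bot] at h1
              rw [subOneProd_cons, h1, map_one, sub_self, zero_mul]
              exact zero_mem _
            | p :: q :: l, hl, hw', hlen =>
              have h1 := doubling_subOneProd (p :: q :: l) [] [] (by simp) (by simp) hl
              simp only [List.nil_append, subOneProd_nil] at h1
              rw [hw', hlen] at h1
              have h2 := ihj h1
              rw [LinearMap.mem_ker, map_sub, map_smul, hφ2, ← sub_smul] at h2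
              refine (smul_eq_zero.1 h2).resolve_left ?_
              have h4 : (2 : ℚ) ^ 2 ≤ 2 ^ j :=
                pow_le_pow_right₀ (by norm_num) (by rw [← hlen]; simp)
              intro h5
              linarith
          · exact ihj h
      refine Submodule.span_le.2 ?_
      rintro _ ⟨l, hl, hw, rfl⟩
      exact hj (l.length + 1) (subOneProd_mem_weightSpan hl (by omega))
  exact main n c (by omega) le_rfl (augIdeal_pow_le_weightSpan c hx)

end Weights

/-! ### The rational Lie algebra is the linear span of the logarithms -/

section LieSpan

variable {G : Type*} [Group G]

theorem log_one : log (1 : G) = 0 := by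
  have := log_mul_of_commute (Commute.refl (1 : G))
  rwa [mul_one, left_eq_add] at this

theorem log_inv (g : G) : log g⁻¹ = -log g := by
  have := log_mul_of_commute (Commute.refl g).inv_right
  rw [mul_inv_cancel, log_one] at this
  exact (neg_eq_of_add_eq_zero_right this.symm).symm

theorem truncLog_mulLeft {R : Type*} [Ring R] [Algebra ℚ R] (n : ℕ) (a : R) :
    truncLog n (LinearMap.mulLeft ℚ a) = LinearMap.mulLeft ℚ (truncLog n a) := by
  ext y
  have h (k : ℕ) : (LinearMap.mulLeft ℚ a - 1) ^ k = LinearMap.mulLeft ℚ ((a - 1) ^ k) := by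
    rw [← LinearMap.pow_mulLeft]
    congr 1
    ext y
    simp [sub_mul]
  simp [truncLog, h, Finset.sum_mul]

theorem truncLog_mulRight {R : Type*} [Ring R] [Algebra ℚ R] (n : ℕ) (a : R) :
    truncLog n (LinearMap.mulRight ℚ a) = LinearMap.mulRight ℚ (truncLog n a) := by
  ext y
  have h (k : ℕ) : (LinearMap.mulRight ℚ a - 1) ^ k = LinearMap.mulRight ℚ ((a - 1) ^ k) := by
    rw [← LinearMap.pow_mulRight]
    congr 1
    ext y
    simp [mul_sub]
  simp [truncLog, h, Finset.mul_sum]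

/-- Left and right multiplications commute, so the logarithm of their product is the sum of their
logarithms. -/
theorem truncLog_mulLeft_mul_mulRight {R : Type*} [Ring R] [Algebra ℚ R] (n : ℕ) {a b : R}
    (ha : (a - 1) ^ n = 0) (hb : (b - 1) ^ n = 0)
    (hab : (LinearMap.mulLeft ℚ a * LinearMap.mulRight ℚ b - 1) ^ n = 0) :
    truncLog n (LinearMap.mulLeft ℚ a * LinearMap.mulRight ℚ b) =
      LinearMap.mulLeft ℚ (truncLog n a) + LinearMap.mulRight ℚ (truncLog n b) := by
  rw [← truncLog_mulLeft, ← truncLog_mulRight]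
  refine truncLog_mul n (LinearMap.ext fun y => (mul_assoc a y b).symm) ?_ ?_ hab
  · have : LinearMap.mulLeft ℚ a - 1 = LinearMap.mulLeft ℚ (a - 1) := by ext y; simp [sub_mul]
    rw [this, LinearMap.pow_mulLeft, ha, LinearMap.mulLeft_zero_eq_zero]
  · have : LinearMap.mulRight ℚ b - 1 = LinearMap.mulRight ℚ (b - 1) := by ext y; simp [mul_sub]
    rw [this, LinearMap.pow_mulRight, hb, LinearMap.mulRight_zero_eq_zero]

theorem truncLog_conj {R : Type*} [Ring R] [Algebra ℚ R] (n : ℕ) {a b : R} (hab : a * b = 1)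
    (hba : b * a = 1) (y : R) : truncLog n (a * (y * b)) = a * (truncLog n y * b) := by
  have hconj : ∀ (y : R) (k : ℕ), a * (y ^ k * b) = (a * (y * b)) ^ k := by
    intro y k
    induction k with
    | zero => simpa using hab
    | succ k ih =>
      rw [pow_succ' (a * (y * b)), ← ih, pow_succ']
      calc a * (y * y ^ k * b) = a * (y * (1 * (y ^ k * b))) := by noncomm_ring
        _ = _ := by rw [← hba]; noncomm_ring
  simp only [truncLog, Finset.mul_sum, Finset.sum_mul, smul_mul_assoc, mul_smul_comm, hconj]
  refine Finset.sum_congr rfl fun k _ => ?_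
  congr 2
  rw [sub_mul, mul_sub, one_mul, hab]

/-- Conjugation by `g` on the group algebra. -/
def conjLin (g : G) : Module.End ℚ (MonoidAlgebra ℚ G) :=
  LinearMap.mulLeft ℚ (MonoidAlgebra.of ℚ G g) * LinearMap.mulRight ℚ (MonoidAlgebra.of ℚ G g⁻¹)

theorem conjLin_apply (g : G) (x : MonoidAlgebra ℚ G) :
    conjLin g x = MonoidAlgebra.of ℚ G g * (x * MonoidAlgebra.of ℚ G g⁻¹) := rfl

/-- Conjugation is unipotent for the augmentation filtration. -/
theorem conjLin_sub_one_pow_mem (g : G) (k : ℕ) (x : MonoidAlgebra ℚ G) :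
    ((conjLin g - 1) ^ k) x ∈ augIdeal G ^ k := by
  induction k with
  | zero => exact pow_zero_mem _
  | succ k ih =>
    rw [pow_succ', Module.End.mul_apply]
    set y := ((conjLin g - 1) ^ k) x
    have h : (conjLin g - 1) y = (MonoidAlgebra.of ℚ G g - 1) * (y * MonoidAlgebra.of ℚ G g⁻¹) +
        y * (MonoidAlgebra.of ℚ G g⁻¹ - 1) := by
      rw [LinearMap.sub_apply, conjLin_apply, Module.End.one_apply]
      noncomm_ring
    rw [h]
    refine add_mem ?_ ?_
    · rw [Ideal.IsTwoSided.pow_succ]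
      exact Ideal.mul_mem_mul (of_sub_one_mem_augIdeal g) (Ideal.mul_mem_right _ _ ih)
    · rw [Submodule.pow_succ]
      exact Ideal.mul_mem_mul ih (of_sub_one_mem_augIdeal g⁻¹)

/-- `[log g, log h] = log (Ad g) (log h)`: the adjoint action of `log g` is the logarithm of the
conjugation by `g`. -/
theorem log_mul_log_sub_apply (g h : G) (n : ℕ) :
    (log g * log h - log h * log g) n = logHom G (truncLog n (conjLin g) (MonoidAlgebra.of ℚ G h)) n := by
  let R := MonoidAlgebra ℚ G ⧸ (augIdeal G ^ n)
  let mk : MonoidAlgebra ℚ G →ₐ[ℚ] R := Ideal.Quotient.mkₐ ℚ (augIdeal G ^ n)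
  let a : R := mk (MonoidAlgebra.of ℚ G g)
  let b : R := mk (MonoidAlgebra.of ℚ G g⁻¹)
  let A : Module.End ℚ R := LinearMap.mulLeft ℚ a * LinearMap.mulRight ℚ b
  have hmk : ∀ (k : ℕ) (x : MonoidAlgebra ℚ G),
      ((A - 1) ^ k) (mk x) = mk (((conjLin g - 1) ^ k) x) := by
    intro k x
    induction k with
    | zero => rfl
    | succ k ih =>
      rw [pow_succ', pow_succ', Module.End.mul_apply, Module.End.mul_apply, ih]
      simp only [LinearMap.sub_apply, conjLin_apply, map_sub, map_mul, Module.End.one_apply]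
      rfl
  have hba : b * a = 1 := by rw [← map_mul, ← map_mul, inv_mul_cancel, map_one, map_one]
  have hab : a * b = 1 := by rw [← map_mul, ← map_mul, mul_inv_cancel, map_one, map_one]
  have hlog : ∀ (k : ℕ) (x : MonoidAlgebra ℚ G),
      ((A - 1) ^ k) (logHom G x n) = logHom G (((conjLin g - 1) ^ k) x) n := by
    have hA : ∀ x, A (logHom G x n) = logHom G (conjLin g x) n := by
      intro x
      have : (A.comp (LinearMap.proj n)).comp (logHom G) =
          (LinearMap.proj n).comp ((logHom G).comp (conjLin g)) := by
        apply linearMap_ext_of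
        intro x
        rw [LinearMap.comp_apply, LinearMap.comp_apply, LinearMap.comp_apply, LinearMap.comp_apply,
          conjLin_apply, ← map_mul, ← map_mul, logHom_of, logHom_of, LinearMap.proj_apply,
          LinearMap.proj_apply, log_apply, log_apply]
        change a * (truncLog n _ * b) = _
        rw [map_mul, map_mul, map_mul, map_mul]
        exact (truncLog_conj n hab hba _).symm
      exact LinearMap.congr_fun this x
    intro k x
    induction k with
    | zero => rfl
    | succ k ih =>
      rw [pow_succ', pow_succ', Module.End.mul_apply, Module.End.mul_apply, ih, LinearMap.sub_apply,
        LinearMap.sub_apply, hA, map_sub]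
      rfl
  have hA : (A - 1) ^ n = 0 := by
    refine LinearMap.ext fun y => ?_
    obtain ⟨x, rfl⟩ := Ideal.Quotient.mk_surjective y
    exact (hmk n x).trans (Ideal.Quotient.eq_zero_iff_mem.2 (conjLin_sub_one_pow_mem g n x))
  have e1 : truncLog n a = log g n := (log_apply g n).symm
  have e2 : truncLog n b = -log g n := by
    rw [← Pi.neg_apply, ← log_inv]
    exact (log_apply g⁻¹ n).symm
  have key : truncLog n A = LinearMap.mulLeft ℚ (truncLog n a) + LinearMap.mulRight ℚ (truncLog n b) :=
    truncLog_mulLeft_mul_mulRight (R := R) n (a := a) (b := b)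
      (mkₐ_of_sub_one_pow g n) (mkₐ_of_sub_one_pow g⁻¹ n) hA
  clear_value A
  have key2 : log g n * log h n - log h n * log g n = truncLog n A (log h n) := by
    rw [key, e1, e2, LinearMap.add_apply, LinearMap.mulLeft_apply, LinearMap.mulRight_apply,
      mul_neg, sub_eq_add_neg]
  refine key2.trans ?_
  simp only [truncLog, LinearMap.sum_apply, LinearMap.smul_apply, map_sum, map_smul,
    Finset.sum_apply, Pi.smul_apply]
  refine Finset.sum_congr rfl fun k _ => ?_
  rw [← logHom_of, hlog]

theorem log_mul_log_sub_mem_range [Group.IsNilpotent G] (g h : G) :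
    log g * log h - log h * log g ∈ LinearMap.range (logHom G) := by
  obtain ⟨c, hc⟩ := Subgroup.nilpotent_iff_lowerCentralSeries.1 ‹Group.IsNilpotent G›
  refine ⟨truncLog c (conjLin g) (MonoidAlgebra.of ℚ G h), ?_⟩
  funext n
  rw [log_mul_log_sub_apply]
  simp only [truncLog, LinearMap.sum_apply, LinearMap.smul_apply, map_sum, map_smul,
    Finset.sum_apply, Pi.smul_apply]
  -- Both truncations can be replaced by a common longer one: the extra terms vanish because they
  -- involve a high power of the augmentation ideal.
  rw [Finset.sum_subset (Finset.range_mono (Nat.le_add_left c n)) fun k _ hk => ?_,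
    Finset.sum_subset (Finset.range_mono (Nat.le_add_right n c)) fun k _ hk => ?_]
  · rw [logHom_apply_eq_zero (augIdeal_pow_le _ (conjLin_sub_one_pow_mem g (k + 1) _)), smul_zero]
    have : n ≤ k := by simpa using hk
    omega
  · have : c ≤ k := by simpa using hk
    rw [logHom_eq_zero hc (augIdeal_pow_le _ (conjLin_sub_one_pow_mem g (k + 1) _)), Pi.zero_apply,
      smul_zero]
    omega

theorem mem_malcevLie [Group.IsNilpotent G] {x : ProQuot G} :
    x ∈ malcevLie G ↔ ∃ y, logHom G y = x := by
  have hspan : LinearMap.range (logHom G) = Submodule.span ℚ (Set.range log) := by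
    rw [logHom, linExt, LinearMap.range_comp, LinearEquiv.range, Submodule.map_top,
      Finsupp.range_linearCombination]
  constructor
  · intro hx
    let L : LieSubalgebra ℚ (ProQuot G) :=
      { LinearMap.range (logHom G) with
        lie_mem' := by
          intro x y hx hy
          change x ∈ LinearMap.range (logHom G) at hx
          change y ∈ LinearMap.range (logHom G) at hy
          change x * y - y * x ∈ LinearMap.range (logHom G)
          rw [hspan] at hx hy
          induction hx, hy using Submodule.span_induction₂ with
          | mem_mem x y hx hy =>
            obtain ⟨g, rfl⟩ := hx
            obtain ⟨h, rfl⟩ := hy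
            exact log_mul_log_sub_mem_range g h
          | zero_left y hy => simp
          | zero_right x hx => simp
          | add_left x y z _ _ _ h1 h2 =>
            rw [show (x + y) * z - z * (x + y) = (x * z - z * x) + (y * z - z * y) by noncomm_ring]
            exact add_mem h1 h2
          | add_right x y z _ _ _ h1 h2 =>
            rw [show x * (y + z) - (y + z) * x = (x * y - y * x) + (x * z - z * x) by noncomm_ring]
            exact add_mem h1 h2
          | smul_left r x y _ _ h =>
            rw [smul_mul_assoc, mul_smul_comm, ← smul_sub]
            exact Submodule.smul_mem _ _ h
          | smul_right r x y _ _ h =>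
            rw [smul_mul_assoc, mul_smul_comm, ← smul_sub]
            exact Submodule.smul_mem _ _ h }
    have hle : malcevLie G ≤ L := by
      refine LieSubalgebra.lieSpan_le.2 ?_
      rintro _ ⟨g, rfl⟩
      exact ⟨MonoidAlgebra.of ℚ G g, logHom_of g⟩
    exact hle hx
  · intro hx
    have hx' : x ∈ LinearMap.range (logHom G) := hx
    rw [hspan] at hx'
    have hle : Submodule.span ℚ (Set.range log) ≤ (malcevLie G).toSubmodule := by
      refine Submodule.span_le.2 ?_
      rintro _ ⟨g, rfl⟩
      exact LieSubalgebra.subset_lieSpan ⟨g, rfl⟩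
    exact hle hx'

theorem log_mem_malcevLie (g : G) : log g ∈ malcevLie G := LieSubalgebra.subset_lieSpan ⟨g, rfl⟩

/-- The linear extension of the logarithm as a map onto the rational Lie algebra. -/
def logLie (G : Type*) [Group G] : MonoidAlgebra ℚ G →ₗ[ℚ] malcevLie G :=
  linExt fun g => ⟨log g, log_mem_malcevLie g⟩

theorem coe_logLie (x : MonoidAlgebra ℚ G) : (logLie G x : ProQuot G) = logHom G x := by
  have : (malcevLie G).toSubmodule.subtype.comp (logLie G) = logHom G := by
    apply linearMap_ext_of
    intro g
    rw [LinearMap.comp_apply, logLie, linExt_of, logHom_of]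
    rfl
  exact LinearMap.congr_fun this x

theorem logLie_surjective [Group.IsNilpotent G] : Function.Surjective (logLie G) := by
  rintro ⟨x, hx⟩
  obtain ⟨y, rfl⟩ := mem_malcevLie.1 hx
  exact ⟨y, Subtype.ext (coe_logLie y)⟩

theorem logLie_eq_zero {c : ℕ} (hc : lcs G c = ⊥) {x : MonoidAlgebra ℚ G}
    (hx : x ∈ augIdeal G ^ (c + 1)) : logLie G x = 0 :=
  Subtype.ext ((coe_logLie x).trans (logHom_eq_zero hc hx))

theorem algMap_of (σ : G →* G) (g : G) :
    algMap σ (MonoidAlgebra.of ℚ G g) = MonoidAlgebra.of ℚ G (σ g) := by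
  simp [algMap]

theorem malcevMap_logLie (σ : G →* G) (x : MonoidAlgebra ℚ G) :
    malcevMap σ (logLie G x) = logLie G (algMap σ x) := by
  have : (malcevMap σ).comp (logLie G) = (logLie G).comp (algMap σ).toLinearMap := by
    apply linearMap_ext_of
    intro g
    rw [LinearMap.comp_apply, LinearMap.comp_apply, AlgHom.toLinearMap_apply, algMap_of, logLie,
      linExt_of, linExt_of]
    exact Subtype.ext (proMap_log σ g)
  exact LinearMap.congr_fun this x

end LieSpan

/-! ### Endomorphisms that are integral over `ℤ[1/π]` -/

section Integrality

variable (π : Set Nat.Primes)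

/-- The non-zero `π`-numbers. -/
def piNumbers : Submonoid ℤ where
  carrier := {n | n ≠ 0 ∧ IsPiNumber π n}
  one_mem' := ⟨one_ne_zero, fun p hp => by
    have := Int.natCast_dvd_natCast.1 (by simpa using hp : ((p : ℕ) : ℤ) ∣ ((1 : ℕ) : ℤ))
    exact absurd (Nat.dvd_one.1 this) p.2.one_lt.ne'⟩
  mul_mem' {a b} ha hb := ⟨mul_ne_zero ha.1 hb.1, fun p hp =>
    ((Nat.prime_iff_prime_int.1 p.2).dvd_or_dvd hp).elim (ha.2 p) (hb.2 p)⟩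

/-- The ring `ℤ[1/π]`. -/
def piRing : Subring ℚ where
  carrier := zInvPi π
  one_mem' := ⟨1, 1, one_ne_zero, (piNumbers π).one_mem.2, by simp⟩
  zero_mem' := ⟨0, 1, one_ne_zero, (piNumbers π).one_mem.2, by simp⟩
  mul_mem' := by
    rintro _ _ ⟨m, n, hn, hn', rfl⟩ ⟨k, l, hl, hl', rfl⟩
    have := (piNumbers π).mul_mem ⟨hn, hn'⟩ ⟨hl, hl'⟩
    exact ⟨m * k, n * l, this.1, this.2, by push_cast; field_simp⟩
  add_mem' := by
    rintro _ _ ⟨m, n, hn, hn', rfl⟩ ⟨k, l, hl, hl', rfl⟩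
    have := (piNumbers π).mul_mem ⟨hn, hn'⟩ ⟨hl, hl'⟩
    have hn0 : (n : ℚ) ≠ 0 := by exact_mod_cast hn
    have hl0 : (l : ℚ) ≠ 0 := by exact_mod_cast hl
    exact ⟨m * l + n * k, n * l, this.1, this.2, by push_cast; field_simp⟩
  neg_mem' := by
    rintro _ ⟨m, n, hn, hn', rfl⟩
    exact ⟨-m, n, hn, hn', by push_cast; ring⟩

instance isLocalization_piRing : IsLocalization (piNumbers π) (piRing π) where
  map_units := by
    rintro ⟨n, hn, hn'⟩
    have hn0 : (n : ℚ) ≠ 0 := by exact_mod_cast hn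
    refine IsUnit.of_mul_eq_one ⟨(1 : ℤ) / n, 1, n, hn, hn', rfl⟩ ?_
    apply Subtype.ext
    simp [hn0]
  surj := by
    rintro ⟨_, m, n, hn, hn', rfl⟩
    have hn0 : (n : ℚ) ≠ 0 := by exact_mod_cast hn
    refine ⟨(m, ⟨n, hn, hn'⟩), ?_⟩
    apply Subtype.ext
    simp [hn0]
  exists_of_eq := by
    intro x y h
    refine ⟨1, ?_⟩
    have : ((algebraMap ℤ (piRing π) x : piRing π) : ℚ) = (algebraMap ℤ (piRing π) y : piRing π) := by
      rw [h]
    simpa using this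

/-- `ℤ[1/π]` is integrally closed in `ℚ`. -/
theorem mem_piRing_of_isIntegral {x : ℚ} (hx : IsIntegral (piRing π) x) : x ∈ piRing π := by
  obtain ⟨⟨n, hn, hn'⟩, h⟩ := hx.exists_multiple_integral_of_isLocalization (piNumbers π) x
  obtain ⟨m, hm⟩ := IsIntegrallyClosed.isIntegral_iff.1 h
  have hn0 : (n : ℚ) ≠ 0 := by exact_mod_cast hn
  refine ⟨m, n, hn, hn', ?_⟩
  have h2 : (m : ℚ) = n * x := by simpa [Submonoid.smul_def] using hm
  rw [h2]
  field_simp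

/-- A linear endomorphism is `π`-integral if it is annihilated by a monic polynomial with
coefficients in `ℤ[1/π]` and with non-zero constant coefficient. -/
def IsPiIntegral {V : Type*} [AddCommGroup V] [Module ℚ V] (f : Module.End ℚ V) : Prop :=
  ∃ P : ℚ[X], (P.Monic ∧ (∀ k, P.coeff k ∈ zInvPi π) ∧ P.coeff 0 ≠ 0) ∧ aeval f P = 0

variable {π}

theorem IsPiIntegral.injective {V : Type*} [AddCommGroup V] [Module ℚ V] {f : Module.End ℚ V}
    (hf : IsPiIntegral π f) : Function.Injective f := by
  obtain ⟨P, ⟨-, -, hP⟩, h⟩ := hf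
  refine (injective_iff_map_eq_zero f).2 fun v hv => ?_
  have h1 := LinearMap.congr_fun h v
  rw [← P.divX_mul_X_add, map_add, map_mul, aeval_X, aeval_C, LinearMap.add_apply,
    Module.End.mul_apply, hv, map_zero, zero_add, Module.algebraMap_end_apply,
    LinearMap.zero_apply] at h1
  exact (smul_eq_zero.1 h1).resolve_left hP

/-- Integrality over `ℤ[1/π]`, in terms of polynomials with rational coefficients. -/
theorem isIntegralElem_iff {R : Type*} [Ring R] [Algebra ℚ R] {x : R} :
    ((algebraMap ℚ R).comp (piRing π).subtype).IsIntegralElem x ↔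
      ∃ P : ℚ[X], P.Monic ∧ (∀ k, P.coeff k ∈ zInvPi π) ∧ aeval x P = 0 := by
  constructor
  · rintro ⟨P, hP, h⟩
    refine ⟨P.map (piRing π).subtype, hP.map _, fun k => ?_, ?_⟩
    · rw [coeff_map]
      exact (P.coeff k).2
    · rwa [aeval_def, eval₂_map]
  · rintro ⟨P, hP, hc, h⟩
    have hl : P ∈ Polynomial.lifts (piRing π).subtype := by
      rw [Polynomial.lifts_iff_coeff_lifts]
      exact fun k => ⟨⟨_, hc k⟩, rfl⟩
    obtain ⟨Q, hQ, -, hQm⟩ := Polynomial.lifts_and_natDegree_eq_and_monic hl hP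
    refine ⟨Q, hQm, ?_⟩
    rw [← eval₂_map, hQ]
    exact h

/-- A power of `X` can be split off from a monic polynomial over `ℤ[1/π]`, so that the constant
coefficient of the cofactor is non-zero. -/
theorem exists_monic_coeff_zero_ne_zero {P : ℚ[X]} (hP : P.Monic) (hc : ∀ k, P.coeff k ∈ zInvPi π) :
    ∃ (m : ℕ) (Q : ℚ[X]), (Q.Monic ∧ (∀ k, Q.coeff k ∈ zInvPi π) ∧ Q.coeff 0 ≠ 0) ∧
      P = X ^ m * Q := by
  obtain ⟨Q, hQ, hX⟩ := Polynomial.exists_eq_pow_rootMultiplicity_mul_and_not_dvd P hP.ne_zero 0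
  rw [C_0, sub_zero] at hQ hX
  set m := P.rootMultiplicity 0
  refine ⟨m, Q, ⟨?_, fun k => ?_, ?_⟩, hQ⟩
  · rw [hQ] at hP
    exact (monic_X_pow m).of_mul_monic_left hP
  · have := hc (k + m)
    rwa [hQ, coeff_X_pow_mul] at this
  · rwa [Ne, ← X_dvd_iff]

/-- The constant coefficient of an annihilating polynomial can be made non-zero exactly when the
endomorphism is injective. -/
theorem isPiIntegral_iff {V : Type*} [AddCommGroup V] [Module ℚ V] {f : Module.End ℚ V} :
    IsPiIntegral π f ↔ Function.Injective f ∧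
      ∃ P : ℚ[X], P.Monic ∧ (∀ k, P.coeff k ∈ zInvPi π) ∧ aeval f P = 0 := by
  refine ⟨fun hf => ⟨hf.injective, ?_⟩, ?_⟩
  · obtain ⟨P, ⟨h1, h2, -⟩, h⟩ := hf
    exact ⟨P, h1, h2, h⟩
  · rintro ⟨hinj, P, hP, hc, h⟩
    obtain ⟨m, Q, hQ, rfl⟩ := exists_monic_coeff_zero_ne_zero hP hc
    refine ⟨Q, hQ, LinearMap.ext fun v => ?_⟩
    rw [map_mul, map_pow, aeval_X] at h
    have h1 := LinearMap.congr_fun h v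
    rw [Module.End.mul_apply, LinearMap.zero_apply] at h1
    have h2 : Function.Injective (f ^ m) := by
      rw [Module.End.coe_pow]
      exact hinj.iterate m
    exact h2 (h1.trans (map_zero _).symm)

/-- Over an algebraic closure the eigenvalues are integral over `ℤ[1/π]`, hence so are the coefficients
of the characteristic polynomial. -/
theorem IsPiIntegral.isIntegral_coeff_charpoly {V : Type*} [AddCommGroup V] [Module ℚ V]
    [FiniteDimensional ℚ V] {f : Module.End ℚ V} (hf : IsPiIntegral π f) (k : ℕ) :
    IsIntegral (piRing π) (f.charpoly.coeff k) := by
  let K := AlgebraicClosure ℚ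
  refine (isIntegral_algHom_iff (IsScalarTower.toAlgHom (piRing π) ℚ K)
    (algebraMap ℚ K).injective).1 ?_
  change IsIntegral (piRing π) (algebraMap ℚ K (f.charpoly.coeff k))
  rw [← coeff_map, ← LinearMap.charpoly_baseChange]
  refine isIntegral_coeff_of_factors _ ?_ (IsAlgClosed.splits _) ?_ k
  · rw [LinearMap.charpoly_monic]
    exact isIntegral_one
  · intro x hx
    rw [← Module.End.hasEigenvalue_iff_isRoot_charpoly] at hx
    obtain ⟨v, hv⟩ := hx.exists_hasEigenvector
    obtain ⟨P, ⟨hP, hc, -⟩, h⟩ := hf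
    have h1 : aeval (f.baseChange K) (P.map (algebraMap ℚ K)) = 0 := by
      rw [aeval_map_algebraMap]
      have := aeval_algHom_apply (Module.End.baseChangeHom ℚ K V) f P
      rw [h, map_zero] at this
      exact this
    have h2 := Module.End.aeval_apply_of_hasEigenvector (p := P.map (algebraMap ℚ K)) hv
    rw [h1, LinearMap.zero_apply] at h2
    have h3 := (smul_eq_zero.1 h2.symm).resolve_right hv.2
    rw [eval_map_algebraMap] at h3
    exact isIntegralElem_iff.2 ⟨P, hP, hc, h3⟩

/-- On a finite-dimensional space the `π`-like automorphisms are the `π`-integral endomorphisms. -/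
theorem isPiLikeAut_iff {V : Type*} [AddCommGroup V] [Module ℚ V]
    [FiniteDimensional ℚ V] {f : V →ₗ[ℚ] V} : IsPiLikeAut π f ↔ IsPiIntegral π f := by
  constructor
  · rintro ⟨hb, hc⟩
    exact isPiIntegral_iff.2 ⟨hb.1, f.charpoly, f.charpoly_monic, hc, f.aeval_self_charpoly⟩
  · intro hf
    exact ⟨⟨hf.injective, LinearMap.injective_iff_surjective.1 hf.injective⟩, fun k =>
      mem_piRing_of_isIntegral π (hf.isIntegral_coeff_charpoly k)⟩

theorem aeval_comm_apply {V W : Type*} [AddCommGroup V] [Module ℚ V] [AddCommGroup W] [Module ℚ W]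
    {f : Module.End ℚ V} {g : Module.End ℚ W} {L : V →ₗ[ℚ] W} (h : ∀ v, L (f v) = g (L v))
    (P : ℚ[X]) (v : V) : L (aeval f P v) = aeval g P (L v) := by
  induction P using Polynomial.induction_on' with
  | add P Q hP hQ => rw [map_add, map_add, LinearMap.add_apply, LinearMap.add_apply, map_add, hP, hQ]
  | monomial n a =>
    rw [aeval_monomial, aeval_monomial, Module.End.mul_apply, Module.End.mul_apply,
      Module.algebraMap_end_apply, Module.algebraMap_end_apply, map_smul]
    congr 1
    induction n with
    | zero => rfl
    | succ n ih => rw [pow_succ', pow_succ', Module.End.mul_apply, Module.End.mul_apply, h, ih]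

theorem IsPiIntegral.of_surjective {V W : Type*} [AddCommGroup V] [Module ℚ V] [AddCommGroup W]
    [Module ℚ W] {f : Module.End ℚ V} {g : Module.End ℚ W} (hf : IsPiIntegral π f) (L : V →ₗ[ℚ] W)
    (hL : Function.Surjective L) (h : ∀ v, L (f v) = g (L v)) : IsPiIntegral π g := by
  obtain ⟨P, hP, hPf⟩ := hf
  refine ⟨P, hP, LinearMap.ext fun w => ?_⟩
  obtain ⟨v, rfl⟩ := hL w
  rw [← aeval_comm_apply h, hPf, LinearMap.zero_apply, map_zero, LinearMap.zero_apply]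

theorem isIntegralElem_mul_of_commute {R : Type*} [Ring R] [Algebra ℚ R] {x y : R}
    (hxy : Commute x y) (hx : ((algebraMap ℚ R).comp (piRing π).subtype).IsIntegralElem x)
    (hy : ((algebraMap ℚ R).comp (piRing π).subtype).IsIntegralElem y) :
    ((algebraMap ℚ R).comp (piRing π).subtype).IsIntegralElem (x * y) := by
  let S := Algebra.adjoin ℚ ({x, y} : Set R)
  have : IsMulCommutative S := Algebra.isMulCommutative_adjoin ℚ (by
    rintro a (rfl | rfl) b (rfl | rfl)
    exacts [rfl, hxy.eq, hxy.eq.symm, rfl])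
  open scoped IsMulCommutative in
  have key : ∀ z : S, ((algebraMap ℚ S).comp (piRing π).subtype).IsIntegralElem z ↔
      ((algebraMap ℚ R).comp (piRing π).subtype).IsIntegralElem (z : R) := by
    intro z
    rw [isIntegralElem_iff, isIntegralElem_iff]
    refine exists_congr fun P => and_congr_right fun _ => and_congr_right fun _ => ?_
    have h : aeval (z : R) P = ((aeval z P : S) : R) := aeval_algHom_apply S.val z P
    rw [h, ZeroMemClass.coe_eq_zero]
  let x' : S := ⟨x, Algebra.subset_adjoin (by simp)⟩
  let y' : S := ⟨y, Algebra.subset_adjoin (by simp)⟩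
  open scoped IsMulCommutative in
  exact (key (x' * y')).1 (((key x').2 hx).mul _ ((key y').2 hy))

/-- Tensor products of `π`-integral endomorphisms are `π`-integral, as products of commuting
integral elements. -/
theorem IsPiIntegral.tensorMap {V W : Type*} [AddCommGroup V] [Module ℚ V] [AddCommGroup W]
    [Module ℚ W] {f : Module.End ℚ V} {g : Module.End ℚ W} (hf : IsPiIntegral π f)
    (hg : IsPiIntegral π g) : IsPiIntegral π (TensorProduct.map f g : Module.End ℚ (V ⊗[ℚ] W)) := by
  obtain ⟨P, ⟨hP, hPc, -⟩, hPf⟩ := id hf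
  obtain ⟨Q, ⟨hQ, hQc, -⟩, hQg⟩ := id hg
  rw [isPiIntegral_iff, ← isIntegralElem_iff]
  refine ⟨?_, ?_⟩
  · exact TensorProduct.map_injective_of_flat_flat f g hf.injective hg.injective
  have h : (TensorProduct.map f g : Module.End ℚ (V ⊗[ℚ] W)) =
      TensorProduct.map f LinearMap.id * TensorProduct.map LinearMap.id g := by
    rw [Module.End.mul_eq_comp, ← TensorProduct.map_comp, LinearMap.comp_id, LinearMap.id_comp]
  rw [h]
  refine isIntegralElem_mul_of_commute ?_ ?_ ?_
  · change _ * _ = _ * _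
    rw [Module.End.mul_eq_comp, Module.End.mul_eq_comp, ← TensorProduct.map_comp,
      ← TensorProduct.map_comp]
    rfl
  · refine isIntegralElem_iff.2 ⟨P, hP, hPc, ?_⟩
    refine TensorProduct.ext' fun v w => ?_
    have := aeval_comm_apply (f := f) (g := (TensorProduct.map f LinearMap.id : Module.End ℚ (V ⊗[ℚ] W)))
      (L := (TensorProduct.mk ℚ V W).flip w) (fun v => rfl) P v
    rw [hPf] at this
    simpa using this.symm
  · refine isIntegralElem_iff.2 ⟨Q, hQ, hQc, ?_⟩
    refine TensorProduct.ext' fun v w => ?_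
    have := aeval_comm_apply (f := g) (g := (TensorProduct.map LinearMap.id g : Module.End ℚ (V ⊗[ℚ] W)))
      (L := TensorProduct.mk ℚ V W v) (fun v => rfl) Q w
    rw [hQg] at this
    simpa using this.symm

/-- The annihilating polynomials of the factors of a filtration multiply to one of the whole space. -/
theorem piPolynomial_mul {P Q : ℚ[X]} (hP : P.Monic ∧ (∀ k, P.coeff k ∈ zInvPi π) ∧ P.coeff 0 ≠ 0)
    (hQ : Q.Monic ∧ (∀ k, Q.coeff k ∈ zInvPi π) ∧ Q.coeff 0 ≠ 0) :
    (P * Q).Monic ∧ (∀ k, (P * Q).coeff k ∈ zInvPi π) ∧ (P * Q).coeff 0 ≠ 0 := by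
  refine ⟨hP.1.mul hQ.1, fun k => ?_, ?_⟩
  · rw [coeff_mul]
    exact (piRing π).sum_mem fun i _ => (piRing π).mul_mem (hP.2.1 _) (hQ.2.1 _)
  · rw [mul_coeff_zero]
    exact mul_ne_zero hP.2.2 hQ.2.2

end Integrality

/-! ### Additive maps from a group to a rational vector space -/

section AdditiveMaps

theorem map_one_of_additive {H X : Type*} [Group H] [AddCommGroup X] {ψ : H → X}
    (hψ : ∀ x y, ψ (x * y) = ψ x + ψ y) : ψ 1 = 0 := by
  have := hψ 1 1
  rwa [mul_one, left_eq_add] at this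

theorem map_inv_of_additive {H X : Type*} [Group H] [AddCommGroup X] {ψ : H → X}
    (hψ : ∀ x y, ψ (x * y) = ψ x + ψ y) (x : H) : ψ x⁻¹ = -ψ x := by
  have := hψ x x⁻¹
  rw [mul_inv_cancel, map_one_of_additive hψ] at this
  exact (neg_eq_of_add_eq_zero_right this.symm).symm

theorem exists_comp_eq_of_ker_le {A B C : Type*} [AddCommGroup A] [Module ℚ A] [AddCommGroup B]
    [Module ℚ B] [AddCommGroup C] [Module ℚ C] {p : A →ₗ[ℚ] B} (hp : Function.Surjective p)
    {D : A →ₗ[ℚ] C} (h : ∀ x, p x = 0 → D x = 0) : ∃ L : B →ₗ[ℚ] C, ∀ x, L (p x) = D x := by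
  obtain ⟨s, hs⟩ := p.exists_rightInverse_of_surjective (LinearMap.range_eq_top.2 hp)
  refine ⟨D.comp s, fun x => ?_⟩
  have h1 := h (s (p x) - x) (by
    have := LinearMap.congr_fun hs (p x)
    rw [LinearMap.comp_apply, LinearMap.id_apply] at this
    rw [map_sub, this, sub_self])
  rwa [map_sub, sub_eq_zero] at h1

theorem linearMap_surjective_of_span {H X W : Type*} [AddCommGroup X]
    [Module ℚ X] [AddCommGroup W] [Module ℚ W] {χ : H → W}
    (hχ : Submodule.span ℚ (Set.range χ) = ⊤) {ψ : H → X}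
    (L : X →ₗ[ℚ] W) (hL : ∀ x, L (ψ x) = χ x) : Function.Surjective L := by
  rw [← LinearMap.range_eq_top, eq_top_iff, ← hχ]
  refine Submodule.span_le.2 ?_
  rintro _ ⟨x, rfl⟩
  exact ⟨ψ x, hL x⟩

variable {H X W : Type*} [Group H] [AddCommGroup X] [Module ℚ X] [AddCommGroup W] [Module ℚ W]

variable {ψ : H → X} (hψ : ∀ x y, ψ (x * y) = ψ x + ψ y)
include hψ

theorem map_pow_of_additive (x : H) (n : ℕ) : ψ (x ^ n) = (n : ℚ) • ψ x := by
  induction n with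
  | zero => simpa using map_one_of_additive hψ
  | succ n ih => rw [pow_succ, hψ, ih, Nat.cast_succ, add_smul, one_smul]

theorem map_zpow_of_additive (x : H) (n : ℤ) : ψ (x ^ n) = (n : ℚ) • ψ x := by
  obtain ⟨m, rfl | rfl⟩ := n.eq_nat_or_neg
  · rw [zpow_natCast, map_pow_of_additive hψ, Int.cast_natCast]
  · rw [zpow_neg, zpow_natCast, map_inv_of_additive hψ, map_pow_of_additive hψ, Int.cast_neg,
      Int.cast_natCast, neg_smul]

/-- Clearing denominators in the rational span of the values of an additive map. -/
theorem exists_smul_eq_of_mem_span {x : X} (hx : x ∈ Submodule.span ℚ (Set.range ψ)) :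
    ∃ n : ℕ, 0 < n ∧ ∃ h, (n : ℚ) • x = ψ h := by
  induction hx using Submodule.span_induction with
  | mem x hx =>
    obtain ⟨h, rfl⟩ := hx
    exact ⟨1, one_pos, h, by simp⟩
  | zero => exact ⟨1, one_pos, 1, by simp [map_one_of_additive hψ]⟩
  | add x y _ _ hx hy =>
    obtain ⟨n, hn, h, hx⟩ := hx
    obtain ⟨m, hm, k, hy⟩ := hy
    refine ⟨n * m, Nat.mul_pos hn hm, h ^ m * k ^ n, ?_⟩
    rw [hψ, map_pow_of_additive hψ, map_pow_of_additive hψ, ← hx, ← hy, smul_add, smul_smul,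
      smul_smul, Nat.cast_mul, mul_comm (m : ℚ)]
  | smul q x _ hx =>
    obtain ⟨n, hn, h, hx⟩ := hx
    refine ⟨n * q.den, Nat.mul_pos hn q.den_pos, h ^ q.num, ?_⟩
    have hq : (q.den : ℚ) * q = q.num := by rw [mul_comm, Rat.mul_den_eq_num]
    rw [map_zpow_of_additive hψ, ← hx, smul_smul, smul_smul, Nat.cast_mul, mul_assoc, hq, mul_comm]

/-- An additive map whose values span is a rationalization modulo its kernel: any other additive map
that vanishes on the kernel factors through it linearly. -/
theorem exists_linear_lift (hspan : Submodule.span ℚ (Set.range ψ) = ⊤) {χ : H → W}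
    (hχ : ∀ x y, χ (x * y) = χ x + χ y) (hker : ∀ x, ψ x = 0 → χ x = 0) :
    ∃ L : X →ₗ[ℚ] W, ∀ x, L (ψ x) = χ x := by
  have hsurj : Function.Surjective (Finsupp.linearCombination ℚ ψ) := by
    rw [← LinearMap.range_eq_top, Finsupp.range_linearCombination, hspan]
  have key : ∀ c, Finsupp.linearCombination ℚ ψ c = 0 → Finsupp.linearCombination ℚ χ c = 0 := by
    intro c hc
    have hmem : (Finsupp.linearCombination ℚ fun h => (ψ h, χ h)) c ∈
        Submodule.span ℚ (Set.range fun h => (ψ h, χ h)) := by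
      rw [← Finsupp.range_linearCombination]
      exact ⟨c, rfl⟩
    obtain ⟨n, hn, h, hh⟩ := exists_smul_eq_of_mem_span
      (ψ := fun h => (ψ h, χ h)) (fun x y => Prod.ext (hψ x y) (hχ x y)) hmem
    have h1 : (Finsupp.linearCombination ℚ fun h => (ψ h, χ h)) c =
        (Finsupp.linearCombination ℚ ψ c, Finsupp.linearCombination ℚ χ c) := by
      simp only [Finsupp.linearCombination_apply, Finsupp.sum]
      refine Prod.ext ?_ ?_
      · rw [Prod.fst_sum]; rfl
      · rw [Prod.snd_sum]; rfl
    rw [h1, hc, Prod.smul_mk, smul_zero, Prod.mk.injEq, hker h] at hh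
    · exact (smul_eq_zero.1 hh.2).resolve_left (by exact_mod_cast hn.ne')
    · exact hh.1.symm
  obtain ⟨L, hL⟩ := exists_comp_eq_of_ker_le hsurj key
  exact ⟨L, fun x => by simpa using hL (Finsupp.single x 1)⟩

end AdditiveMaps

/-! ### The logarithm on an abelian group -/

section Abelian

variable {G : Type*} [Group G]

instance malcevLieAddCommGroup : AddCommGroup (malcevLie G) := inferInstance

instance malcevLieModule : Module ℚ (malcevLie G) := inferInstance

/-- The logarithm as a map to the rational Lie algebra. -/
def lieLog (g : G) : malcevLie G := ⟨log g, log_mem_malcevLie g⟩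

theorem logLie_of (g : G) : logLie G (MonoidAlgebra.of ℚ G g) = lieLog g := linExt_of _ _

theorem span_range_lieLog [Group.IsNilpotent G] :
    Submodule.span ℚ (Set.range (lieLog : G → malcevLie G)) = ⊤ := by
  rw [← LinearMap.range_eq_top.2 (logLie_surjective (G := G)), logLie, linExt, LinearMap.range_comp,
    LinearEquiv.range, Submodule.map_top, Finsupp.range_linearCombination]
  rfl

theorem malcevMap_lieLog (σ : G →* G) (g : G) : malcevMap σ (lieLog g) = lieLog (σ g) :=
  Subtype.ext (proMap_log σ g)

theorem lieLog_mul (hG : ∀ a b : G, a * b = b * a) (a b : G) :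
    lieLog (a * b) = lieLog a + lieLog b :=
  Subtype.ext (log_mul_of_commute (hG a b))

/-- The linear extension of an additive map vanishes on the square of the augmentation ideal. -/
theorem linExt_eq_zero_of_mem_sq {W : Type*} [AddCommGroup W] [Module ℚ W] {χ : G → W}
    (hχ : ∀ x y, χ (x * y) = χ x + χ y) {x : MonoidAlgebra ℚ G} (hx : x ∈ augIdeal G ^ 2) :
    linExt χ x = 0 := by
  refine augIdeal_pow_succ_le (LinearMap.ker (linExt χ)) 1 (fun y hy g => ?_) hx
  rw [Submodule.pow_one] at hy
  have : (linExt χ).comp (LinearMap.mulRight ℚ (MonoidAlgebra.of ℚ G g - 1)) =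
      (LinearMap.toSpanSingleton ℚ W (χ g)).comp (augmentation G).toLinearMap := by
    apply linearMap_ext_of
    intro h
    rw [LinearMap.comp_apply, LinearMap.comp_apply, LinearMap.mulRight_apply, mul_sub, mul_one,
      ← map_mul, map_sub, linExt_of, linExt_of, hχ, AlgHom.toLinearMap_apply, augmentation_of,
      LinearMap.toSpanSingleton_apply, one_smul, add_sub_cancel_left]
  have h := LinearMap.congr_fun this y
  rw [LinearMap.comp_apply, LinearMap.comp_apply, AlgHom.toLinearMap_apply, mem_augIdeal.1 hy,
    map_zero] at h
  exact h

/-- Modulo `I²` the logarithm of `g` is `g - 1`, on which the linear extension of an additive map `χ`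
takes the value `χ g`. -/
theorem eq_zero_of_log_eq_zero {W : Type*} [AddCommGroup W] [Module ℚ W] {χ : G → W}
    (hχ : ∀ x y, χ (x * y) = χ x + χ y) {g : G} (hg : log g = 0) : χ g = 0 := by
  have h := congrFun hg 2
  rw [log, Pi.zero_apply] at h
  have h1 := linExt_eq_zero_of_mem_sq hχ (Ideal.Quotient.eq_zero_iff_mem.1 h)
  have h2 : linExt χ ((MonoidAlgebra.of ℚ G g - 1) ^ 2) = 0 := by
    refine linExt_eq_zero_of_mem_sq hχ ?_
    exact Ideal.pow_mem_pow (of_sub_one_mem_augIdeal g) 2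
  have h3 : linExt χ (1 : MonoidAlgebra ℚ G) = 0 := by
    rw [← map_one (MonoidAlgebra.of ℚ G), linExt_of, map_one_of_additive hχ]
  rw [Finset.sum_range_succ, Finset.sum_range_one, map_add, map_smul, map_smul, h2, zero_add, pow_one,
    map_sub, h3, linExt_of] at h1
  simpa using h1

/-- The embedding of a torsion-free abelian group in a rational vector space. -/
theorem exists_injective_additive (hG : ∀ a b : G, a * b = b * a) (htf : TorsionFree G) :
    ∃ χ : G → ℚ ⊗[ℤ] Additive (Abelianization G), (∀ x y, χ (x * y) = χ x + χ y) ∧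
      ∀ g, χ g = 0 → g = 1 := by
  let A := Additive (Abelianization G)
  let f : A →ₗ[ℤ] ℚ ⊗[ℤ] A := TensorProduct.mk ℤ ℚ A 1
  have hf : IsLocalizedModule (nonZeroDivisors ℤ) f :=
    (isLocalizedModule_iff_isBaseChange (nonZeroDivisors ℤ) ℚ f).2 (TensorProduct.isBaseChange ℤ A ℚ)
  refine ⟨fun g => f (Additive.ofMul (Abelianization.of g)), fun x y => ?_, fun g hg => ?_⟩
  · change f (Additive.ofMul (Abelianization.of (x * y))) = _
    rw [map_mul, ofMul_mul, map_add]
  · obtain ⟨⟨c, hc⟩, h⟩ := (IsLocalizedModule.eq_zero_iff (nonZeroDivisors ℤ) f).1 hg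
    have hc0 : c ≠ 0 := nonZeroDivisors.ne_zero hc
    have h1 : Abelianization.of (g ^ c) = 1 := by
      rw [map_zpow]
      exact h
    have h2 : g ^ c = 1 := by
      have : g ^ c ∈ (Abelianization.of : G →* _).ker := h1
      rw [Abelianization.ker_of, commutator_def] at this
      have hbot : ⁅(⊤ : Subgroup G), (⊤ : Subgroup G)⁆ = ⊥ := by
        rw [Subgroup.commutator_eq_bot_iff_le_centralizer]
        intro x _
        rw [Subgroup.mem_centralizer_iff]
        exact fun y _ => hG y x
      rwa [hbot, Subgroup.mem_bot] at this
    exact htf g (isOfFinOrder_iff_zpow_eq_one.2 ⟨c, hc0, h2⟩)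

theorem lieLog_eq_zero_iff (hG : ∀ a b : G, a * b = b * a) (htf : TorsionFree G) (g : G) :
    lieLog g = 0 ↔ g = 1 := by
  constructor
  · intro hg
    obtain ⟨χ, hχ, h⟩ := exists_injective_additive hG htf
    exact h g (eq_zero_of_log_eq_zero hχ (congrArg Subtype.val hg))
  · rintro rfl
    exact Subtype.ext log_one

end Abelian

/-! ### The isolated lower central series -/

section Isolated

variable {G : Type*} [Group G]

theorem commutatorElement_pow_of_commute {x y : G} (h : Commute x ⁅x, y⁆) (n : ℕ) :
    ⁅x ^ n, y⁆ = ⁅x, y⁆ ^ n := by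
  have key : ∀ n : ℕ, x ^ n * y = ⁅x, y⁆ ^ n * y * x ^ n := by
    intro n
    induction n with
    | zero => simp
    | succ n ih =>
      have h1 : x * y = ⁅x, y⁆ * y * x := by rw [commutatorElement_def]; group
      calc x ^ (n + 1) * y = x * (x ^ n * y) := by rw [pow_succ', mul_assoc]
        _ = x * ⁅x, y⁆ ^ n * y * x ^ n := by rw [ih]; group
        _ = ⁅x, y⁆ ^ n * (x * y) * x ^ n := by rw [(h.pow_right n).eq]; group
        _ = ⁅x, y⁆ ^ n * (⁅x, y⁆ * y * x) * x ^ n := by rw [← h1]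
        _ = ⁅x, y⁆ ^ (n + 1) * y * x ^ (n + 1) := by rw [pow_succ ⁅x, y⁆, pow_succ' x]; group
  rw [commutatorElement_def (x ^ n), key n]
  group

/-- If `[x, y]` commutes with `x` modulo `K`, then the commutator with `y` is compatible with powers of `x`
modulo `K`. -/
theorem commutatorElement_pow_mem_iff {K : Subgroup G} [K.Normal] {x y : G} (h : ⁅⁅x, y⁆, x⁆ ∈ K)
    (n : ℕ) : ⁅x ^ n, y⁆ ∈ K ↔ ⁅x, y⁆ ^ n ∈ K := by
  have h1 : Commute (x : G ⧸ K) ⁅(x : G ⧸ K), (y : G ⧸ K)⁆ := by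
    apply Commute.symm
    rw [← commutatorElement_eq_one_iff_commute]
    exact (QuotientGroup.eq_one_iff _).2 h
  have h2 : ((⁅x ^ n, y⁆ : G) : G ⧸ K) = ((⁅x, y⁆ ^ n : G) : G ⧸ K) :=
    commutatorElement_pow_of_commute h1 n
  rw [← QuotientGroup.eq_one_iff, h2, QuotientGroup.eq_one_iff]

/-- The upper central factors of a torsion-free group are torsion-free. -/
theorem mem_upperCentralSeries_of_pow_mem (htf : TorsionFree G) (i : ℕ) :
    ∀ {x : G} {n : ℕ}, 0 < n → x ∈ Subgroup.upperCentralSeries G (i + 1) →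
      x ^ n ∈ Subgroup.upperCentralSeries G i → x ∈ Subgroup.upperCentralSeries G i := by
  induction i with
  | zero =>
    intro x n hn _ hx
    rw [Subgroup.upperCentralSeries_zero, Subgroup.mem_bot] at *
    exact htf x (isOfFinOrder_iff_pow_eq_one.2 ⟨n, hn, hx⟩)
  | succ i ih =>
    intro x n hn hx hxn
    rw [Subgroup.mem_upperCentralSeries_succ_iff] at hx hxn ⊢
    intro y
    refine ih hn (hx y) ?_
    rw [← commutatorElement_pow_mem_iff (Subgroup.mem_upperCentralSeries_succ_iff.1 (hx y) x)]
    exact hxn y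

/-- The isolated lower central series: the term `j + 1` consists of the elements of the term `j` that
have finite order modulo the commutator of the term `j` with `G`. -/
def isoLcs (G : Type*) [Group G] : ℕ → Subgroup G
  | 0 => ⊤
  | j + 1 => Subgroup.closure {x | x ∈ isoLcs G j ∧ ∃ n : ℕ, 0 < n ∧ x ^ n ∈ ⁅isoLcs G j, (⊤ : Subgroup G)⁆}

instance isoLcs_normal (j : ℕ) : (isoLcs G j).Normal := by
  induction j with
  | zero => exact inferInstanceAs (⊤ : Subgroup G).Normal
  | succ j ih =>
    rw [← Subgroup.normalizer_eq_top_iff, eq_top_iff, isoLcs]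
    refine le_trans ?_ (Subgroup.normalizer_le_normalizer_closure _)
    intro g _
    rw [Subgroup.mem_set_normalizer_iff]
    have key : ∀ (g x : G), (x ∈ isoLcs G j ∧ ∃ n : ℕ, 0 < n ∧ x ^ n ∈ ⁅isoLcs G j, (⊤ : Subgroup G)⁆) →
        (g * x * g⁻¹ ∈ isoLcs G j ∧ ∃ n : ℕ, 0 < n ∧
          (g * x * g⁻¹) ^ n ∈ ⁅isoLcs G j, (⊤ : Subgroup G)⁆) := by
      rintro g x ⟨hx, n, hn, hxn⟩
      refine ⟨ih.conj_mem x hx g, n, hn, ?_⟩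
      rw [conj_pow]
      exact Subgroup.Normal.conj_mem inferInstance _ hxn g
    refine fun x => ⟨key g x, fun h => ?_⟩
    have := key g⁻¹ _ h
    rwa [show g⁻¹ * (g * x * g⁻¹) * g⁻¹⁻¹ = x by group] at this

theorem mem_isoLcs_succ {j : ℕ} {x : G} : x ∈ isoLcs G (j + 1) ↔
    x ∈ isoLcs G j ∧ ∃ n : ℕ, 0 < n ∧ x ^ n ∈ ⁅isoLcs G j, (⊤ : Subgroup G)⁆ := by
  refine ⟨fun hx => ?_, fun hx => Subgroup.subset_closure hx⟩
  rw [isoLcs] at hx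
  induction hx using Subgroup.closure_induction with
  | mem x hx => exact hx
  | one => exact ⟨one_mem _, 1, one_pos, by simp⟩
  | mul x y _ _ hx hy =>
    obtain ⟨hx, n, hn, hxn⟩ := hx
    obtain ⟨hy, m, hm, hym⟩ := hy
    refine ⟨mul_mem hx hy, n * m, Nat.mul_pos hn hm, ?_⟩
    let K := ⁅isoLcs G j, (⊤ : Subgroup G)⁆
    rw [← QuotientGroup.eq_one_iff] at hxn hym ⊢
    have hc : Commute (x : G ⧸ K) (y : G ⧸ K) := by
      rw [← commutatorElement_eq_one_iff_commute]
      exact (QuotientGroup.eq_one_iff _).2 (Subgroup.commutator_mem_commutator hx (Subgroup.mem_top y))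
    have hx1 : (x : G ⧸ K) ^ n = 1 := hxn
    have hy1 : (y : G ⧸ K) ^ m = 1 := hym
    change ((x : G ⧸ K) * (y : G ⧸ K)) ^ (n * m) = 1
    rw [hc.mul_pow, pow_mul, hx1, one_pow, one_mul, mul_comm n, pow_mul, hy1, one_pow]
  | inv x _ hx =>
    obtain ⟨hx, n, hn, hxn⟩ := hx
    exact ⟨inv_mem hx, n, hn, by rw [inv_pow]; exact inv_mem hxn⟩

theorem isoLcs_succ_le (j : ℕ) : isoLcs G (j + 1) ≤ isoLcs G j := fun _ hx => (mem_isoLcs_succ.1 hx).1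

theorem isoLcs_antitone : Antitone (isoLcs G) := antitone_nat_of_succ_le isoLcs_succ_le

theorem commutator_isoLcs_top_le (j : ℕ) : ⁅isoLcs G j, (⊤ : Subgroup G)⁆ ≤ isoLcs G (j + 1) :=
  fun x hx => mem_isoLcs_succ.2
    ⟨Subgroup.commutator_le_left _ _ hx, 1, one_pos, by rwa [pow_one]⟩

theorem mem_isoLcs_succ_of_pow_mem {j : ℕ} {x : G} (hx : x ∈ isoLcs G j) {n : ℕ} (hn : 0 < n)
    (hxn : x ^ n ∈ isoLcs G (j + 1)) : x ∈ isoLcs G (j + 1) := by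
  obtain ⟨-, m, hm, h⟩ := mem_isoLcs_succ.1 hxn
  exact mem_isoLcs_succ.2 ⟨hx, n * m, Nat.mul_pos hn hm, by rwa [pow_mul]⟩

theorem map_mem_isoLcs (σ : G →* G) (j : ℕ) : ∀ {x : G}, x ∈ isoLcs G j → σ x ∈ isoLcs G j := by
  induction j with
  | zero => exact fun _ => Subgroup.mem_top _
  | succ j ih =>
    intro x hx
    obtain ⟨hx, n, hn, hxn⟩ := mem_isoLcs_succ.1 hx
    refine mem_isoLcs_succ.2 ⟨ih hx, n, hn, ?_⟩
    rw [← map_pow]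
    have h1 : (⁅isoLcs G j, (⊤ : Subgroup G)⁆).map σ ≤ ⁅isoLcs G j, (⊤ : Subgroup G)⁆ := by
      rw [Subgroup.map_commutator]
      refine Subgroup.commutator_mono ?_ le_top
      rintro _ ⟨y, hy, rfl⟩
      exact ih hy
    exact h1 (Subgroup.mem_map_of_mem σ hxn)

theorem isoLcs_one : isoLcs G 1 = isolatedDerived G := by
  ext x
  rw [mem_isoLcs_succ]
  change _ ↔ IsOfFinOrder (Abelianization.of x)
  rw [isOfFinOrder_iff_pow_eq_one]
  simp only [← map_pow]
  refine ⟨fun h => ?_, fun h => ⟨Subgroup.mem_top x, ?_⟩⟩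
  · obtain ⟨-, n, hn, h⟩ := h
    refine ⟨n, hn, ?_⟩
    rw [← MonoidHom.mem_ker, Abelianization.ker_of]
    exact h
  · obtain ⟨n, hn, h⟩ := h
    refine ⟨n, hn, ?_⟩
    rwa [← MonoidHom.mem_ker, Abelianization.ker_of] at h

/-- The isolated lower central series centralizes the upper central series to the same extent as the
lower central series does, because the upper central factors are torsion-free. -/
theorem commutator_isoLcs_upperCentralSeries_le (htf : TorsionFree G) (j : ℕ) : ∀ i,
    ⁅isoLcs G j, Subgroup.upperCentralSeries G (i + j + 1)⁆ ≤ Subgroup.upperCentralSeries G i := by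
  induction j with
  | zero =>
    intro i
    rw [Subgroup.commutator_comm]
    exact Subgroup.commutator_upperCentralSeries_top_le G i
  | succ j ih =>
    intro i
    have h3 : ⁅⁅isoLcs G j, (⊤ : Subgroup G)⁆, Subgroup.upperCentralSeries G (i + (j + 1) + 1)⁆ ≤
        Subgroup.upperCentralSeries G i := by
      refine commutator_commutator_le_of_rotate ?_ ?_
      · rw [Subgroup.commutator_comm ⊤]
        refine (Subgroup.commutator_mono (Subgroup.commutator_upperCentralSeries_top_le G _) le_rfl).trans ?_
        rw [Subgroup.commutator_comm]
        exact ih i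
      · rw [Subgroup.commutator_comm _ (isoLcs G j)]
        refine (Subgroup.commutator_mono ?_ le_rfl).trans
          (Subgroup.commutator_upperCentralSeries_top_le G i)
        have := ih (i + 1)
        rwa [show i + 1 + j + 1 = i + (j + 1) + 1 by omega] at this
    refine Subgroup.commutator_le.2 fun x hx z hz => ?_
    obtain ⟨hxj, n, hn, hxn⟩ := mem_isoLcs_succ.1 hx
    have h1 : ⁅x, z⁆ ∈ Subgroup.upperCentralSeries G (i + 1) := by
      refine ih (i + 1) (Subgroup.commutator_mem_commutator hxj ?_)
      rwa [show i + 1 + j + 1 = i + (j + 1) + 1 by omega]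
    refine mem_upperCentralSeries_of_pow_mem htf i hn h1 ?_
    rw [← commutatorElement_pow_mem_iff (Subgroup.mem_upperCentralSeries_succ_iff.1 h1 x)]
    exact h3 (Subgroup.commutator_mem_commutator hxn hz)

/-- The isolated lower central series of a torsion-free nilpotent group reaches the trivial group. -/
theorem exists_isoLcs_succ_eq_bot [Group.IsNilpotent G] (htf : TorsionFree G) :
    ∃ c, isoLcs G (c + 1) = ⊥ := by
  obtain ⟨c, hc⟩ := Group.IsNilpotent.nilpotent G
  refine ⟨c, (Subgroup.eq_bot_iff_forall _).2 fun x hx => ?_⟩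
  obtain ⟨-, n, hn, hxn⟩ := mem_isoLcs_succ.1 hx
  have h1 := commutator_isoLcs_upperCentralSeries_le htf c 0
  have h2 : Subgroup.upperCentralSeries G (0 + c + 1) = ⊤ :=
    top_le_iff.1 (hc ▸ Subgroup.upperCentralSeries_mono G (by omega))
  rw [h2, Subgroup.upperCentralSeries_zero] at h1
  exact htf x (isOfFinOrder_iff_pow_eq_one.2 ⟨n, hn, h1 hxn⟩)

/-- Commutation with the isolated derived subgroup moves two steps down the isolated lower central
series. -/
theorem commutator_isoLcs_isoLcs_one_le (k : ℕ) : ⁅isoLcs G k, isoLcs G 1⁆ ≤ isoLcs G (k + 2) := by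
  have h3 : ⁅⁅(⊤ : Subgroup G), (⊤ : Subgroup G)⁆, isoLcs G k⁆ ≤ isoLcs G (k + 2) := by
    have h : ⁅⁅isoLcs G k, (⊤ : Subgroup G)⁆, (⊤ : Subgroup G)⁆ ≤ isoLcs G (k + 2) :=
      (Subgroup.commutator_mono (commutator_isoLcs_top_le k) le_rfl).trans
        (commutator_isoLcs_top_le (k + 1))
    refine commutator_commutator_le_of_rotate ?_ h
    rwa [Subgroup.commutator_comm ⊤]
  rw [Subgroup.commutator_comm]
  refine Subgroup.commutator_le.2 fun y hy x hx => ?_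
  obtain ⟨-, n, hn, hyn⟩ := mem_isoLcs_succ.1 hy
  have h1 : ⁅y, x⁆ ∈ isoLcs G (k + 1) := by
    refine commutator_isoLcs_top_le k ?_
    rw [Subgroup.commutator_comm]
    exact Subgroup.commutator_mem_commutator (Subgroup.mem_top y) hx
  refine mem_isoLcs_succ_of_pow_mem h1 hn ?_
  rw [← commutatorElement_pow_mem_iff (commutator_isoLcs_top_le (k + 1)
    (Subgroup.commutator_mem_commutator h1 (Subgroup.mem_top y)))]
  exact h3 (Subgroup.commutator_mem_commutator hyn hx)

/-- The isolated lower central series, in increasing order, as an invariant central series. -/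
def isoSeries (σ : G →* G) (c : ℕ) (hc : isoLcs G c = ⊥) : InvariantCentralSeries σ where
  H i := isoLcs G (c - i)
  length := c
  mono i j h := isoLcs_antitone (by omega)
  bot := hc
  top := by rw [Nat.sub_self]; rfl
  central i := by
    rcases Nat.lt_or_ge i c with h | h
    · rw [show c - i = c - (i + 1) + 1 by omega]
      exact commutator_isoLcs_top_le _
    · rw [show c - i = 0 by omega]
      exact le_top
  preserved i := by
    rintro _ ⟨x, hx, rfl⟩
    exact map_mem_isoLcs σ _ hx
  torsionFree i x hx n hn hxn := by
    rcases Nat.lt_or_ge i c with h | h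
    · rw [show c - i = c - (i + 1) + 1 by omega] at hxn ⊢
      exact mem_isoLcs_succ_of_pow_mem hx hn hxn
    · rw [show c - i = 0 by omega]
      exact Subgroup.mem_top x

end Isolated

/-! ### Logarithms on the sections of a series -/

section Sections

variable {G : Type*} [Group G] {σ : G →* G}

namespace InvariantCentralSeries

variable (S : InvariantCentralSeries σ) (i : ℕ)

/-- The logarithm of the class of an element in a section. -/
def secLog (x : S.H (i + 1)) : malcevLie (S.Sec i) := lieLog (x : S.Sec i)

theorem sec_comm (a b : S.Sec i) : a * b = b * a := by
  obtain ⟨a, rfl⟩ := QuotientGroup.mk_surjective a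
  obtain ⟨b, rfl⟩ := QuotientGroup.mk_surjective b
  rw [← commutatorElement_eq_one_iff_mul_comm]
  exact (QuotientGroup.eq_one_iff _).2 (Subgroup.mem_subgroupOf.2
    (S.central i (Subgroup.commutator_mem_commutator a.2 (Subgroup.mem_top (b : G)))))

theorem sec_torsionFree : TorsionFree (S.Sec i) := by
  intro a ha
  obtain ⟨a, rfl⟩ := QuotientGroup.mk_surjective a
  obtain ⟨n, hn, han⟩ := isOfFinOrder_iff_pow_eq_one.1 ha
  exact (QuotientGroup.eq_one_iff _).2 (Subgroup.mem_subgroupOf.2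
    (S.torsionFree i a a.2 n hn (Subgroup.mem_subgroupOf.1 ((QuotientGroup.eq_one_iff _).1 han))))

theorem secLog_mul (x y : S.H (i + 1)) : S.secLog i (x * y) = S.secLog i x + S.secLog i y := by
  rw [secLog, secLog, secLog, ← lieLog_mul (S.sec_comm i)]
  rfl

theorem secLog_eq_zero_iff (x : S.H (i + 1)) : S.secLog i x = 0 ↔ (x : G) ∈ S.H i :=
  (lieLog_eq_zero_iff (S.sec_comm i) (S.sec_torsionFree i) _).trans (QuotientGroup.eq_one_iff x)

theorem span_range_secLog [Group.IsNilpotent G] :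
    Submodule.span ℚ (Set.range (S.secLog i)) = ⊤ := by
  rw [eq_top_iff, ← span_range_lieLog (G := S.Sec i)]
  refine Submodule.span_mono ?_
  rintro _ ⟨a, rfl⟩
  obtain ⟨a, rfl⟩ := QuotientGroup.mk_surjective a
  exact ⟨a, rfl⟩

theorem malcevMap_secLog (x : S.H (i + 1)) :
    malcevMap (S.secMap i) (S.secLog i x) = S.secLog i (S.restrict (i + 1) x) :=
  malcevMap_lieLog _ _

end InvariantCentralSeries

/-- The logarithm of the class of an element in the torsion-free abelianisation. -/
def abLog (x : G) : malcevLie (G ⧸ isolatedDerived G) := lieLog (x : G ⧸ isolatedDerived G)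

theorem quotient_isolatedDerived_comm (a b : G ⧸ isolatedDerived G) : a * b = b * a := by
  obtain ⟨a, rfl⟩ := QuotientGroup.mk_surjective a
  obtain ⟨b, rfl⟩ := QuotientGroup.mk_surjective b
  rw [← commutatorElement_eq_one_iff_mul_comm]
  refine (QuotientGroup.eq_one_iff _).2 ?_
  rw [← isoLcs_one]
  exact commutator_isoLcs_top_le 0
    (Subgroup.commutator_mem_commutator (Subgroup.mem_top a) (Subgroup.mem_top b))

theorem abLog_mul (x y : G) : abLog (x * y) = abLog x + abLog y := by
  rw [abLog, abLog, abLog, ← lieLog_mul quotient_isolatedDerived_comm]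
  rfl

theorem quotient_isolatedDerived_torsionFree : TorsionFree (G ⧸ isolatedDerived G) := by
  intro a ha
  obtain ⟨a, rfl⟩ := QuotientGroup.mk_surjective a
  obtain ⟨n, hn, han⟩ := isOfFinOrder_iff_pow_eq_one.1 ha
  refine (QuotientGroup.eq_one_iff _).2 ?_
  have h1 : a ^ n ∈ isolatedDerived G := (QuotientGroup.eq_one_iff _).1 han
  rw [← isoLcs_one] at h1 ⊢
  exact mem_isoLcs_succ_of_pow_mem (Subgroup.mem_top a) hn h1

theorem abLog_eq_zero_iff (x : G) : abLog x = 0 ↔ x ∈ isolatedDerived G :=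
  (lieLog_eq_zero_iff quotient_isolatedDerived_comm quotient_isolatedDerived_torsionFree _).trans
    (QuotientGroup.eq_one_iff x)

theorem span_range_abLog [Group.IsNilpotent G] :
    Submodule.span ℚ (Set.range (abLog : G → _)) = ⊤ := by
  rw [eq_top_iff, ← span_range_lieLog (G := G ⧸ isolatedDerived G)]
  refine Submodule.span_mono ?_
  rintro _ ⟨a, rfl⟩
  obtain ⟨a, rfl⟩ := QuotientGroup.mk_surjective a
  exact ⟨a, rfl⟩

theorem malcevMap_abLog (σ : G →* G) (x : G) :
    malcevMap (abelianisationMap σ) (abLog x) = abLog (σ x) :=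
  malcevMap_lieLog _ _

end Sections

/-! ### `π`-like endomorphisms and the torsion-free abelianisation -/

section Comparison

variable {π : Set Nat.Primes}

theorem isPiLike_iff {G : Type*} [Group G] {σ : G →* G} :
    IsPiLike π σ ↔ FiniteDimensional ℚ (malcevLie G) ∧ IsPiIntegral π (malcevMap σ) := by
  constructor
  · rintro ⟨h, h1⟩
    exact ⟨h, isPiLikeAut_iff.1 h1⟩
  · rintro ⟨h, h1⟩
    exact ⟨h, isPiLikeAut_iff.2 h1⟩

theorem IsPiLike.of_surjective {G G' : Type*} [Group G] [Group G'] {σ : G →* G} {σ' : G' →* G'}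
    (h : IsPiLike π σ) (L : malcevLie G →ₗ[ℚ] malcevLie G') (hL : Function.Surjective L)
    (hσ : ∀ v, L (malcevMap σ v) = malcevMap σ' (L v)) : IsPiLike π σ' := by
  rw [isPiLike_iff] at *
  have := h.1
  exact ⟨Module.Finite.of_surjective L hL, h.2.of_surjective L hL hσ⟩

variable {G : Type*} [Group G] (σ : G →* G)

/-- Additive maps factor through the logarithm: they are determined modulo `I²`, where `log g` is
`g - 1`. -/
theorem linExt_eq_zero_of_logHom_eq_zero {W : Type*} [AddCommGroup W] [Module ℚ W] {χ : G → W}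
    (hχ : ∀ x y, χ (x * y) = χ x + χ y) {x : MonoidAlgebra ℚ G} (hx : logHom G x = 0) :
    linExt χ x = 0 := by
  let A : MonoidAlgebra ℚ G →ₗ[ℚ] MonoidAlgebra ℚ G :=
    linExt fun g => ∑ k ∈ Finset.range 2,
      ((-1 : ℚ) ^ k / ((k : ℚ) + 1)) • (MonoidAlgebra.of ℚ G g - 1) ^ (k + 1)
  have h1 : (linExt χ).comp A = linExt χ := by
    apply linearMap_ext_of
    intro g
    have h2 : linExt χ ((MonoidAlgebra.of ℚ G g - 1) ^ 2) = 0 :=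
      linExt_eq_zero_of_mem_sq hχ (Ideal.pow_mem_pow (of_sub_one_mem_augIdeal g) 2)
    have h3 : linExt χ (1 : MonoidAlgebra ℚ G) = 0 := by
      rw [← map_one (MonoidAlgebra.of ℚ G), linExt_of, map_one_of_additive hχ]
    rw [LinearMap.comp_apply, linExt_of, linExt_of, Finset.sum_range_succ, Finset.sum_range_one,
      map_add, map_smul, map_smul, h2, zero_add, pow_one, map_sub, h3, linExt_of]
    simp
  have h2 : (Ideal.Quotient.mkₐ ℚ (augIdeal G ^ 2)).toLinearMap.comp A =
      (LinearMap.proj 2).comp (logHom G) := by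
    apply linearMap_ext_of
    intro g
    rw [LinearMap.comp_apply, LinearMap.comp_apply, linExt_of, logHom_of]
    rfl
  have h3 : Ideal.Quotient.mkₐ ℚ (augIdeal G ^ 2) (A x) = 0 := by
    refine (LinearMap.congr_fun h2 x).trans ?_
    rw [LinearMap.comp_apply, hx, map_zero]
  rw [← h1]
  exact linExt_eq_zero_of_mem_sq hχ (Ideal.Quotient.eq_zero_iff_mem.1 h3)

/-- The rational Lie algebra of a nilpotent group maps onto that of the torsion-free
abelianisation. -/
theorem isPiLike_abelianisationMap_of_isPiLike [Group.IsNilpotent G] (h : IsPiLike π σ) :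
    IsPiLike π (abelianisationMap σ) := by
  obtain ⟨L, hL⟩ := exists_comp_eq_of_ker_le (logLie_surjective (G := G))
    (D := linExt (abLog : G → _)) fun x hx => linExt_eq_zero_of_logHom_eq_zero abLog_mul (by
      rw [← coe_logLie, hx]; rfl)
  have hL' : ∀ g : G, L (lieLog g) = abLog g := fun g => by rw [← logLie_of, hL, linExt_of]
  refine h.of_surjective L (linearMap_surjective_of_span span_range_abLog L hL') fun v => ?_
  have : L.comp (malcevMap σ) = (malcevMap (abelianisationMap σ)).comp L := by
    refine LinearMap.ext_on_range span_range_lieLog fun g => ?_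
    rw [LinearMap.comp_apply, LinearMap.comp_apply, malcevMap_lieLog, hL', hL', malcevMap_abLog]
  exact LinearMap.congr_fun this v

/-- The torsion-free abelianisation is a section of the isolated lower central series. -/
theorem isPiLike_abelianisationMap_of_isoSeries [Group.IsNilpotent G] (c : ℕ)
    (hc : isoLcs G (c + 1) = ⊥) (h : IsPiLike π ((isoSeries σ (c + 1) hc).secMap c)) :
    IsPiLike π (abelianisationMap σ) := by
  let S := isoSeries σ (c + 1) hc
  have htop : S.H (c + 1) = ⊤ := S.top
  have hone : S.H c = isolatedDerived G := by
    rw [← isoLcs_one]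
    change isoLcs G (c + 1 - c) = _
    rw [Nat.add_sub_cancel_left]
  obtain ⟨L, hL⟩ := exists_linear_lift (S.secLog_mul c) (S.span_range_secLog c)
    (χ := fun x => abLog (x : G)) (fun x y => abLog_mul _ _) fun x hx => by
      rw [abLog_eq_zero_iff, ← hone]
      exact (S.secLog_eq_zero_iff c x).1 hx
  have hspan : Submodule.span ℚ (Set.range fun x : S.H (c + 1) => abLog (x : G)) = ⊤ := by
    rw [eq_top_iff, ← span_range_abLog]
    refine Submodule.span_mono ?_
    rintro _ ⟨x, rfl⟩
    exact ⟨⟨x, htop ▸ Subgroup.mem_top x⟩, rfl⟩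
  refine h.of_surjective L (linearMap_surjective_of_span hspan L hL) fun v => ?_
  have : L.comp (malcevMap (S.secMap c)) = (malcevMap (abelianisationMap σ)).comp L := by
    refine LinearMap.ext_on_range (S.span_range_secLog c) fun g => ?_
    rw [LinearMap.comp_apply, LinearMap.comp_apply, S.malcevMap_secLog, hL, hL, malcevMap_abLog]
    rfl
  exact LinearMap.congr_fun this v

/-- The top section of the isolated lower central series is the torsion-free abelianisation. -/
theorem isPiIntegral_isoSeries_top [Group.IsNilpotent G] (c : ℕ)
    (hc : isoLcs G (c + 1) = ⊥) (h : IsPiIntegral π (malcevMap (abelianisationMap σ))) :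
    IsPiIntegral π (malcevMap ((isoSeries σ (c + 1) hc).secMap c)) := by
  let S := isoSeries σ (c + 1) hc
  have htop : S.H (c + 1) = ⊤ := S.top
  have hone : S.H c = isolatedDerived G := by
    rw [← isoLcs_one]
    change isoLcs G (c + 1 - c) = _
    rw [Nat.add_sub_cancel_left]
  have hmem : ∀ x : G, x ∈ S.H (c + 1) := fun x => htop ▸ Subgroup.mem_top x
  obtain ⟨L, hL⟩ := exists_linear_lift abLog_mul span_range_abLog
    (χ := fun x : G => S.secLog c ⟨x, hmem x⟩) (fun x y => S.secLog_mul c ⟨x, hmem x⟩ ⟨y, hmem y⟩)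
    fun x hx => by
      rw [S.secLog_eq_zero_iff, hone]
      exact (abLog_eq_zero_iff x).1 hx
  have hspan : Submodule.span ℚ (Set.range fun x : G => S.secLog c ⟨x, hmem x⟩) = ⊤ := by
    rw [eq_top_iff, ← S.span_range_secLog c]
    refine Submodule.span_mono ?_
    rintro _ ⟨x, rfl⟩
    exact ⟨x, rfl⟩
  refine h.of_surjective L (linearMap_surjective_of_span hspan L hL) fun v => ?_
  have : L.comp (malcevMap (abelianisationMap σ)) = (malcevMap (S.secMap c)).comp L := by
    refine LinearMap.ext_on_range span_range_abLog fun g => ?_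
    rw [LinearMap.comp_apply, LinearMap.comp_apply, malcevMap_abLog, hL, hL, S.malcevMap_secLog]
    rfl
  exact LinearMap.congr_fun this v

end Comparison

/-! ### Sections of central series -/

section CentralSections

variable {π : Set Nat.Primes} {G : Type*} [Group G]

/-- The elements of a subgroup that an additive map sends to a given submodule. -/
def additiveComap {X : Type*} [AddCommGroup X] [Module ℚ X] {K : Subgroup G} {ψ : K → X}
    (hψ : ∀ x y, ψ (x * y) = ψ x + ψ y) (M : Submodule ℚ X) : Subgroup G where
  carrier := {w | ∃ hw : w ∈ K, ψ ⟨w, hw⟩ ∈ M}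
  one_mem' := ⟨K.one_mem, by
    have : ψ ⟨1, K.one_mem⟩ = 0 := map_one_of_additive hψ
    rw [this]
    exact M.zero_mem⟩
  mul_mem' := by
    rintro a b ⟨ha, ha'⟩ ⟨hb, hb'⟩
    refine ⟨K.mul_mem ha hb, ?_⟩
    have : ψ ⟨a * b, K.mul_mem ha hb⟩ = ψ ⟨a, ha⟩ + ψ ⟨b, hb⟩ := hψ ⟨a, ha⟩ ⟨b, hb⟩
    rw [this]
    exact M.add_mem ha' hb'
  inv_mem' := by
    rintro a ⟨ha, ha'⟩
    refine ⟨K.inv_mem ha, ?_⟩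
    have : ψ ⟨a⁻¹, K.inv_mem ha⟩ = -ψ ⟨a, ha⟩ := map_inv_of_additive hψ ⟨a, ha⟩
    rw [this]
    exact M.neg_mem ha'

/-- In a group of finite rank, the rationalizations of abelian sections are finite-dimensional. -/
theorem finite_of_finiteRank (hrank : FiniteRank G) {X : Type*} [AddCommGroup X] [Module ℚ X]
    {K : Subgroup G} {ψ : K → X} (hψ : ∀ x y, ψ (x * y) = ψ x + ψ y)
    (hspan : Submodule.span ℚ (Set.range ψ) = ⊤) : Module.Finite ℚ X := by
  classical
  obtain ⟨r, hr⟩ := hrank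
  have key : Module.rank ℚ X ≤ r := by
    refine rank_le fun s hs => ?_
    have hden : ∀ x : X, ∃ h : K, x ∈ Submodule.span ℚ {ψ h} := fun x => by
      obtain ⟨n, hn, h, hx⟩ := exists_smul_eq_of_mem_span hψ (hspan ▸ Submodule.mem_top : x ∈ _)
      refine ⟨h, ?_⟩
      rw [← hx, Submodule.span_singleton_smul_eq (IsUnit.mk0 (n : ℚ) (by exact_mod_cast hn.ne'))]
      exact Submodule.mem_span_singleton_self x
    choose h hh using hden
    let t : Finset G := s.image fun x => (h x : G)
    obtain ⟨S, hS, hSt⟩ := hr (Subgroup.closure (t : Set G)) ⟨t, rfl⟩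
    have hSK : ∀ w ∈ S, w ∈ K := by
      intro w hw
      have hle : Subgroup.closure (t : Set G) ≤ K := by
        rw [Subgroup.closure_le]
        intro g hg
        obtain ⟨x, -, rfl⟩ := Finset.mem_image.1 hg
        exact (h x).2
      exact hle (hSt ▸ Subgroup.subset_closure hw)
    let U : Finset X := S.attach.image fun w => ψ ⟨w.1, hSK w.1 w.2⟩
    have hU : Subgroup.closure (S : Set G) ≤ additiveComap hψ (Submodule.span ℚ (U : Set X)) := by
      rw [Subgroup.closure_le]
      intro w hw
      exact ⟨hSK w hw, Submodule.subset_span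
        (Finset.mem_image.2 ⟨⟨w, hw⟩, Finset.mem_attach _ _, rfl⟩)⟩
    have hsU : (s : Set X) ⊆ Submodule.span ℚ (U : Set X) := by
      intro x hx
      have h1 : (h x : G) ∈ Subgroup.closure (S : Set G) :=
        hSt ▸ Subgroup.subset_closure (Finset.mem_image_of_mem _ hx)
      obtain ⟨_, h2⟩ := hU h1
      exact (Submodule.span_singleton_le_iff_mem _ _).2 h2 (hh x)
    have h3 : s.card ≤ U.card := by
      have h4 := linearIndependent_le_span' _ hs (U : Set X) (by simpa using hsU)
      simpa using h4
    exact h3.trans (Finset.card_image_le.trans (by rwa [Finset.card_attach]))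
  exact Module.rank_lt_aleph0_iff.1 (key.trans_lt (Cardinal.natCast_lt_aleph0))

theorem mem_of_map_pow_mem {X : Type*} [AddCommGroup X] [Module ℚ X] {ψ : G → X}
    (hψ : ∀ x y, ψ (x * y) = ψ x + ψ y) {M : Submodule ℚ X} {z : G} {n : ℕ} (hn : 0 < n)
    (h : ψ (z ^ n) ∈ M) : ψ z ∈ M := by
  rw [map_pow_of_additive hψ] at h
  exact (Submodule.smul_mem_iff _ (by exact_mod_cast hn.ne')).1 h

/-- A biadditive map from two groups to a rational vector space induces a linear map on the tensor
product of their rationalizations. If it is equivariant and its values span, then `π`-integrality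
passes from the factors to the target. -/
theorem isPiIntegral_of_biadditive {H X Y Z : Type*} [Group H] [AddCommGroup X] [Module ℚ X]
    [AddCommGroup Y] [Module ℚ Y] [AddCommGroup Z] [Module ℚ Z] {ψ : H → X} {θ : G → Y}
    {b : H → G → Z} (hψ : ∀ x x', ψ (x * x') = ψ x + ψ x') (hθ : ∀ y y', θ (y * y') = θ y + θ y')
    (hψs : Submodule.span ℚ (Set.range ψ) = ⊤) (hθs : Submodule.span ℚ (Set.range θ) = ⊤)
    (hbl : ∀ x x' y, b (x * x') y = b x y + b x' y) (hbr : ∀ x y y', b x (y * y') = b x y + b x y')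
    (hkl : ∀ x y, ψ x = 0 → b x y = 0) (hkr : ∀ x y, θ y = 0 → b x y = 0)
    (hb : ∀ M : Submodule ℚ Z, (∀ x y, b x y ∈ M) → M = ⊤)
    {f : Module.End ℚ X} {g : Module.End ℚ Y} {h : Module.End ℚ Z} {τ : H → H} {σ : G → G}
    (hf : ∀ x, f (ψ x) = ψ (τ x)) (hg : ∀ y, g (θ y) = θ (σ y))
    (hh : ∀ x y, h (b x y) = b (τ x) (σ y)) (hfi : IsPiIntegral π f) (hgi : IsPiIntegral π g) :
    IsPiIntegral π h := by
  have hlift : ∀ y, ∃ L : X →ₗ[ℚ] Z, ∀ x, L (ψ x) = b x y := fun y =>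
    exists_linear_lift hψ hψs (fun x x' => hbl x x' y) fun x hx => hkl x y hx
  choose L hL using hlift
  obtain ⟨B, hB⟩ := exists_linear_lift hθ hθs (χ := L)
    (fun y y' => LinearMap.ext_on_range hψs fun x => by
      rw [hL, LinearMap.add_apply, hL, hL, hbr])
    fun y hy => LinearMap.ext_on_range hψs fun x => by rw [hL, LinearMap.zero_apply, hkr x y hy]
  have hBL : ∀ y x, TensorProduct.lift B (θ y ⊗ₜ ψ x) = b x y := fun y x => by
    rw [TensorProduct.lift.tmul, hB, hL]
  refine (hgi.tensorMap hfi).of_surjective (TensorProduct.lift B) ?_ fun t => ?_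
  · rw [← LinearMap.range_eq_top]
    exact hb _ fun x y => ⟨_, hBL y x⟩
  · have : (TensorProduct.lift B).comp (TensorProduct.map g f) = h.comp (TensorProduct.lift B) := by
      refine TensorProduct.ext ?_
      refine LinearMap.ext_on_range hθs fun y => LinearMap.ext_on_range hψs fun x => ?_
      change TensorProduct.lift B (g (θ y) ⊗ₜ f (ψ x)) = h (TensorProduct.lift B (θ y ⊗ₜ ψ x))
      rw [hf, hg, hBL, hBL, hh]
    exact LinearMap.congr_fun this t

/-- The commutator map makes a section of a central series, up to isogeny, an equivariant quotient of
the tensor product of the section above it with the torsion-free abelianisation. -/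
theorem isPiIntegral_secMap_of_succ [Group.IsNilpotent G] {σ : G →* G}
    (S : InvariantCentralSeries σ) (i : ℕ) (h1 : ⁅S.H (i + 2), isolatedDerived G⁆ ≤ S.H i)
    (h2 : ∀ z ∈ S.H (i + 1), ∃ n : ℕ, 0 < n ∧ z ^ n ∈ ⁅S.H (i + 2), (⊤ : Subgroup G)⁆)
    (hi : IsPiIntegral π (malcevMap (S.secMap (i + 1))))
    (hab : IsPiIntegral π (malcevMap (abelianisationMap σ))) :
    IsPiIntegral π (malcevMap (S.secMap i)) := by
  have hcom : ∀ (x : S.H (i + 2)) (y : G), ⁅(x : G), y⁆ ∈ S.H (i + 1) := fun x y =>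
    S.central (i + 1) (Subgroup.commutator_mem_commutator x.2 (Subgroup.mem_top y))
  let b : S.H (i + 2) → G → malcevLie (S.Sec i) := fun x y => S.secLog i ⟨⁅(x : G), y⁆, hcom x y⟩
  have hconj : ∀ (c : S.H (i + 1)) (g : G) (hg : g * c * g⁻¹ ∈ S.H (i + 1)),
      S.secLog i ⟨g * c * g⁻¹, hg⟩ = S.secLog i c := by
    intro c g hg
    have hc : ⁅g, (c : G)⁆ ∈ S.H i := by
      rw [← commutatorElement_inv]
      exact inv_mem (S.central i (Subgroup.commutator_mem_commutator c.2 (Subgroup.mem_top g)))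
    have h3 : (⟨g * c * g⁻¹, hg⟩ : S.H (i + 1)) = ⟨⁅g, (c : G)⁆, S.mono (Nat.le_succ i) hc⟩ * c :=
      Subtype.ext (by
        change g * c * g⁻¹ = ⁅g, (c : G)⁆ * c
        rw [commutatorElement_def]
        group)
    rw [h3, S.secLog_mul, (S.secLog_eq_zero_iff i _).2 hc, zero_add]
  have hbx : ∀ x x' y, b (x * x') y = b x y + b x' y := by
    intro x x' y
    have h4 := S.normal (i + 1) |>.conj_mem _ (hcom x' y) (x : G)
    have h3 : (⟨⁅((x * x' : S.H (i + 2)) : G), y⁆, hcom (x * x') y⟩ : S.H (i + 1)) =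
        ⟨(x : G) * ⁅(x' : G), y⁆ * (x : G)⁻¹, h4⟩ * ⟨⁅(x : G), y⁆, hcom x y⟩ :=
      Subtype.ext (by
        change ⁅(x : G) * (x' : G), y⁆ = (x : G) * ⁅(x' : G), y⁆ * (x : G)⁻¹ * ⁅(x : G), y⁆
        rw [commutatorElement_def, commutatorElement_def, commutatorElement_def]
        group)
    change S.secLog i _ = _
    rw [h3, S.secLog_mul, hconj ⟨_, hcom x' y⟩]
    exact add_comm _ _
  have hby : ∀ x y y', b x (y * y') = b x y + b x y' := by
    intro x y y'
    have h4 := S.normal (i + 1) |>.conj_mem _ (hcom x y') y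
    have h3 : (⟨⁅(x : G), y * y'⁆, hcom x (y * y')⟩ : S.H (i + 1)) =
        ⟨⁅(x : G), y⁆, hcom x y⟩ * ⟨y * ⁅(x : G), y'⁆ * y⁻¹, h4⟩ :=
      Subtype.ext (by
        change ⁅(x : G), y * y'⁆ = ⁅(x : G), y⁆ * (y * ⁅(x : G), y'⁆ * y⁻¹)
        rw [commutatorElement_def, commutatorElement_def, commutatorElement_def]
        group)
    change S.secLog i _ = _
    rw [h3, S.secLog_mul, hconj ⟨_, hcom x y'⟩]
  refine isPiIntegral_of_biadditive (b := b) (τ := S.restrict (i + 2)) (σ := σ)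
    (S.secLog_mul (i + 1)) (abLog_mul (G := G)) (S.span_range_secLog (i + 1)) span_range_abLog
    hbx hby (fun x y hx => ?_) (fun x y hy => ?_) (fun M hM => ?_)
    (S.malcevMap_secLog (i + 1)) (malcevMap_abLog σ) (fun x y => ?_) hi hab
  · refine (S.secLog_eq_zero_iff i _).2 ?_
    exact S.central i (Subgroup.commutator_mem_commutator
      ((S.secLog_eq_zero_iff (i + 1) x).1 hx) (Subgroup.mem_top y))
  · refine (S.secLog_eq_zero_iff i _).2 (h1 (Subgroup.commutator_mem_commutator x.2 ?_))
    exact (abLog_eq_zero_iff y).1 hy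
  · rw [eq_top_iff, ← S.span_range_secLog i]
    refine Submodule.span_le.2 ?_
    rintro _ ⟨z, rfl⟩
    obtain ⟨n, hn, hz⟩ := h2 z z.2
    have hle : ⁅S.H (i + 2), (⊤ : Subgroup G)⁆ ≤ additiveComap (S.secLog_mul i) M :=
      Subgroup.commutator_le.2 fun x hx y _ => ⟨hcom ⟨x, hx⟩ y, hM ⟨x, hx⟩ y⟩
    obtain ⟨hzn, h3⟩ := hle hz
    exact mem_of_map_pow_mem (S.secLog_mul i) hn h3
  · refine (S.malcevMap_secLog i _).trans ?_
    refine congrArg (S.secLog i) (Subtype.ext ?_)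
    exact map_commutatorElement σ (x : G) y

/-- Downward induction on the isolated lower central series, which starts with the torsion-free
abelianisation at the top. -/
theorem isPiIntegral_isoSeries [Group.IsNilpotent G] (σ : G →* G) (c : ℕ)
    (hc : isoLcs G (c + 1) = ⊥) (h : IsPiIntegral π (malcevMap (abelianisationMap σ))) (k : ℕ) :
    ∀ i, i + k = c → IsPiIntegral π (malcevMap ((isoSeries σ (c + 1) hc).secMap i)) := by
  induction k with
  | zero =>
    rintro i rfl
    exact isPiIntegral_isoSeries_top σ _ hc h
  | succ k ih =>
    intro i hi
    refine isPiIntegral_secMap_of_succ _ i ?_ (fun z hz => ?_) (ih (i + 1) (by omega)) h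
    · change ⁅isoLcs G (c + 1 - (i + 2)), _⁆ ≤ isoLcs G (c + 1 - i)
      rw [← isoLcs_one, show c + 1 - i = c + 1 - (i + 2) + 2 by omega]
      exact commutator_isoLcs_isoLcs_one_le _
    · change z ∈ isoLcs G (c + 1 - (i + 1)) at hz
      rw [show c + 1 - (i + 1) = c + 1 - (i + 2) + 1 by omega, mem_isoLcs_succ] at hz
      exact hz.2

/-- The values of an additive map are closed under integer polynomials in the endomorphism. -/
theorem exists_eq_aeval_apply {X : Type*} [AddCommGroup X] [Module ℚ X] {ψ : G → X}
    (hψ : ∀ x y, ψ (x * y) = ψ x + ψ y) {τ : G →* G} {f : Module.End ℚ X}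
    (hf : ∀ x, ψ (τ x) = f (ψ x)) (q : ℤ[X]) (x : G) :
    ∃ y, ψ y = aeval f (q.map (Int.castRingHom ℚ)) (ψ x) := by
  induction q using Polynomial.induction_on' with
  | add p q hp hq =>
    obtain ⟨y, hy⟩ := hp
    obtain ⟨z, hz⟩ := hq
    exact ⟨y * z, by rw [hψ, hy, hz, Polynomial.map_add, map_add, LinearMap.add_apply]⟩
  | monomial n a =>
    have h : ∀ n : ℕ, ∃ y, ψ y = (f ^ n) (ψ x) := by
      intro n
      induction n with
      | zero => exact ⟨x, rfl⟩
      | succ n ih =>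
        obtain ⟨y, hy⟩ := ih
        exact ⟨τ y, by rw [hf, hy, pow_succ', Module.End.mul_apply]⟩
    obtain ⟨y, hy⟩ := h n
    refine ⟨y ^ a, ?_⟩
    rw [map_zpow_of_additive hψ, hy, map_monomial, aeval_monomial, Module.End.mul_apply,
      Module.algebraMap_end_apply]
    rfl

theorem exists_int_polynomial_map_eq_smul (Q : ℚ[X]) :
    ∃ n : ℤ, n ≠ 0 ∧ ∃ q : ℤ[X], q.map (Int.castRingHom ℚ) = (n : ℚ) • Q := by
  obtain ⟨b, hb, h⟩ := IsLocalization.integerNormalization_spec (nonZeroDivisors ℤ) Q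
  refine ⟨b, nonZeroDivisors.ne_zero hb, _, h.trans ?_⟩
  ext k
  simp

/-- If `Q` annihilates the rationalization by `ψ`, then some non-zero multiple of `Q` maps the values of
any other additive map `φ` to its values on the kernel of `ψ`. -/
theorem exists_smul_aeval_eq {X Y : Type*} [AddCommGroup X] [Module ℚ X] [AddCommGroup Y] [Module ℚ Y]
    {ψ : G → X} {φ : G → Y} (hψ : ∀ x y, ψ (x * y) = ψ x + ψ y)
    (hφ : ∀ x y, φ (x * y) = φ x + φ y) {τ : G →* G} {f : Module.End ℚ X} {g : Module.End ℚ Y}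
    (hf : ∀ x, f (ψ x) = ψ (τ x)) (hg : ∀ x, g (φ x) = φ (τ x)) {Q : ℚ[X]} (hQ : aeval f Q = 0)
    (x : G) : ∃ (n : ℤ) (y : G), n ≠ 0 ∧ ψ y = 0 ∧ φ y = (n : ℚ) • aeval g Q (φ x) := by
  obtain ⟨n, hn, q, hq⟩ := exists_int_polynomial_map_eq_smul Q
  obtain ⟨y, hy⟩ := exists_eq_aeval_apply (ψ := fun x => (ψ x, φ x)) (τ := τ) (f := f.prodMap g)
    (fun x y => Prod.ext (hψ x y) (hφ x y))
    (fun x => Prod.ext (hf x).symm (hg x).symm) q x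
  rw [hq, map_smul, LinearMap.smul_apply] at hy
  refine ⟨n, y, hn, ?_, ?_⟩
  · have h1 := aeval_comm_apply (f := f.prodMap g) (g := f) (L := LinearMap.fst ℚ X Y)
      (fun _ => rfl) Q (ψ x, φ x)
    rw [hQ, LinearMap.zero_apply] at h1
    have h2 := congrArg (LinearMap.fst ℚ X Y) hy
    rw [map_smul, h1, smul_zero] at h2
    exact h2
  · have h1 := aeval_comm_apply (f := f.prodMap g) (g := g) (L := LinearMap.snd ℚ X Y)
      (fun _ => rfl) Q (ψ x, φ x)
    have h2 := congrArg (LinearMap.snd ℚ X Y) hy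
    rw [map_smul, h1] at h2
    exact h2

/-- If all the sections of one invariant central series are `π`-integral, then so are the sections of
every other one: each of them is filtered by the first series, with subquotients of the sections of
the first series as factors. -/
theorem isPiIntegral_secMap_of_forall [Group.IsNilpotent G] {σ : G →* G}
    (E S : InvariantCentralSeries σ)
    (hE : ∀ k, k < E.length → IsPiIntegral π (malcevMap (E.secMap k))) (i : ℕ) :
    IsPiIntegral π (malcevMap (S.secMap i)) := by
  have key : ∀ k ≤ E.length, ∃ P : ℚ[X], (P.Monic ∧ (∀ k, P.coeff k ∈ zInvPi π) ∧ P.coeff 0 ≠ 0) ∧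
      ∀ x : S.H (i + 1), (x : G) ∈ E.H k → aeval (malcevMap (S.secMap i)) P (S.secLog i x) = 0 := by
    intro k
    induction k with
    | zero =>
      intro _
      refine ⟨1, ⟨monic_one, fun k => ?_, by simp⟩, fun x hx => ?_⟩
      · rw [coeff_one]
        split_ifs
        exacts [(piRing π).one_mem, (piRing π).zero_mem]
      · rw [E.bot, Subgroup.mem_bot] at hx
        rw [(S.secLog_eq_zero_iff i x).2 (by rw [hx]; exact one_mem _), map_zero]
    | succ k ih =>
      intro hk
      obtain ⟨P, hP, hPk⟩ := ih (by omega)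
      obtain ⟨Q, hQ, hQk⟩ := hE k (by omega)
      refine ⟨P * Q, piPolynomial_mul hP hQ, fun x hx => ?_⟩
      let K : Subgroup G := E.H (k + 1) ⊓ S.H (i + 1)
      let τ : K →* K := (σ.comp K.subtype).codRestrict K fun x =>
        ⟨E.preserved _ (Subgroup.mem_map_of_mem σ x.2.1), S.preserved _ (Subgroup.mem_map_of_mem σ x.2.2)⟩
      obtain ⟨n, y, hn, hy1, hy2⟩ := exists_smul_aeval_eq (τ := τ)
        (ψ := fun x : K => E.secLog k ⟨x, x.2.1⟩) (φ := fun x : K => S.secLog i ⟨x, x.2.2⟩)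
        (fun x y => E.secLog_mul k ⟨x, x.2.1⟩ ⟨y, y.2.1⟩)
        (fun x y => S.secLog_mul i ⟨x, x.2.2⟩ ⟨y, y.2.2⟩)
        (fun x => E.malcevMap_secLog k ⟨x, x.2.1⟩)
        (fun x => S.malcevMap_secLog i ⟨x, x.2.2⟩) hQk ⟨x, hx, x.2⟩
      have h3 := hPk ⟨y, y.2.2⟩ ((E.secLog_eq_zero_iff k ⟨y, y.2.1⟩).1 hy1)
      rw [hy2, map_smul] at h3
      rw [map_mul, Module.End.mul_apply]
      exact (smul_eq_zero.1 h3).resolve_left (by exact_mod_cast hn)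
  obtain ⟨P, hP, h⟩ := key E.length le_rfl
  refine ⟨P, hP, LinearMap.ext_on_range (S.span_range_secLog i) fun x => ?_⟩
  rw [h x (E.top ▸ Subgroup.mem_top _), LinearMap.zero_apply]

end CentralSections

/-! ### The powers of the augmentation ideal -/

section AugmentationPowers

universe u

variable {π : Set Nat.Primes} {G : Type u} [Group G] {σ : G →* G}

theorem eq_zero_of_mem_isolatedDerived {W : Type*} [AddCommGroup W] [Module ℚ W] {χ : G → W}
    (hχ : ∀ x y, χ (x * y) = χ x + χ y) {g : G} (hg : g ∈ isolatedDerived G) : χ g = 0 := by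
  let f : G →* Multiplicative W :=
    { toFun := fun x => Multiplicative.ofAdd (χ x)
      map_one' := congrArg Multiplicative.ofAdd (map_one_of_additive hχ)
      map_mul' := fun x y => congrArg Multiplicative.ofAdd (hχ x y) }
  have h1 : IsOfFinOrder (Abelianization.of g) := hg
  obtain ⟨n, hn, h2⟩ := isOfFinOrder_iff_pow_eq_one.1 h1
  have h3 : f (g ^ n) = 1 := by
    rw [← Abelianization.lift_apply_of f (g ^ n), map_pow, h2, map_one]
  have h4 : χ (g ^ n) = 0 := h3
  rw [map_pow_of_additive hχ] at h4
  exact (smul_eq_zero.1 h4).resolve_left (by exact_mod_cast hn.ne')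

/-- Modulo the square of the augmentation ideal, `g - 1` is additive in `g`. -/
theorem mkₐ_of_mul_sub_one (x y : G) :
    Ideal.Quotient.mkₐ ℚ (augIdeal G ^ 2) (MonoidAlgebra.of ℚ G (x * y) - 1) =
      Ideal.Quotient.mkₐ ℚ (augIdeal G ^ 2) (MonoidAlgebra.of ℚ G x - 1) +
        Ideal.Quotient.mkₐ ℚ (augIdeal G ^ 2) (MonoidAlgebra.of ℚ G y - 1) := by
  have h1 : Ideal.Quotient.mkₐ ℚ (augIdeal G ^ 2)
      ((MonoidAlgebra.of ℚ G x - 1) * (MonoidAlgebra.of ℚ G y - 1)) = 0 := by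
    refine Ideal.Quotient.eq_zero_iff_mem.2 ?_
    refine mul_mem_augIdeal_pow (m := 1) (n := 1) ?_ ?_ <;>
      · rw [Submodule.pow_one]
        exact of_sub_one_mem_augIdeal _
  have h2 : MonoidAlgebra.of ℚ G (x * y) - 1 =
      (MonoidAlgebra.of ℚ G x - 1) * (MonoidAlgebra.of ℚ G y - 1) +
        ((MonoidAlgebra.of ℚ G x - 1) + (MonoidAlgebra.of ℚ G y - 1)) := by
    rw [map_mul]
    noncomm_ring
  rw [h2, map_add, h1, zero_add, map_add]

/-- On the augmentation ideal, the linear extension of the logarithm of the torsion-free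
abelianisation has kernel `I²`. -/
theorem mem_augIdeal_sq_of_linExt_abLog_eq_zero [Group.IsNilpotent G] {x : MonoidAlgebra ℚ G} (hx : x ∈ augIdeal G)
    (h : linExt (abLog : G → _) x = 0) : x ∈ augIdeal G ^ 2 := by
  obtain ⟨L, hL⟩ := exists_linear_lift abLog_mul span_range_abLog
    (χ := fun g : G => Ideal.Quotient.mkₐ ℚ (augIdeal G ^ 2) (MonoidAlgebra.of ℚ G g - 1))
    mkₐ_of_mul_sub_one fun g hg =>
      eq_zero_of_mem_isolatedDerived
        (χ := fun g : G => Ideal.Quotient.mkₐ ℚ (augIdeal G ^ 2) (MonoidAlgebra.of ℚ G g - 1))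
        mkₐ_of_mul_sub_one ((abLog_eq_zero_iff g).1 hg)
  have h1 : L.comp (linExt (abLog : G → _)) =
      (Ideal.Quotient.mkₐ ℚ (augIdeal G ^ 2)).toLinearMap.comp
        (linExt fun g => MonoidAlgebra.of ℚ G g - 1) := by
    apply linearMap_ext_of
    intro g
    rw [LinearMap.comp_apply, LinearMap.comp_apply, linExt_of, linExt_of, hL]
    rfl
  have h2 := LinearMap.congr_fun h1 x
  rw [LinearMap.comp_apply, LinearMap.comp_apply, h, map_zero, linExt_of_sub_one,
    mem_augIdeal.1 hx, map_zero, sub_zero] at h2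
  exact Ideal.Quotient.eq_zero_iff_mem.1 h2.symm

/-- A linear map `μ` to `Iᵏ`, where `I` is the augmentation ideal, that induces a surjection onto
`Iᵏ/Iᵏ⁺¹` under which the endomorphism `h` corresponds to the action of `σ`. -/
structure IsPowerPresentation (σ : G →* G) (k : ℕ) {T : Type*} [AddCommGroup T] [Module ℚ T]
    (h : Module.End ℚ T) (μ : T →ₗ[ℚ] MonoidAlgebra ℚ G) : Prop where
  mem : ∀ t, μ t ∈ augIdeal G ^ k
  exists_sub_mem : ∀ x ∈ augIdeal G ^ k, ∃ t, x - μ t ∈ augIdeal G ^ (k + 1)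
  comm : ∀ t, algMap σ (μ t) - μ (h t) ∈ augIdeal G ^ (k + 1)

/-- The rationalized torsion-free abelianisation presents `I/I²`. -/
theorem exists_isPowerPresentation_one [Group.IsNilpotent G] (σ : G →* G) :
    ∃ μ, IsPowerPresentation σ 1 (malcevMap (abelianisationMap σ)) μ := by
  let θ := linExt (abLog : G → malcevLie (G ⧸ isolatedDerived G))
  obtain ⟨s, hs⟩ := θ.exists_rightInverse_of_surjective (LinearMap.range_eq_top.2
    (linearMap_surjective_of_span span_range_abLog (ψ := MonoidAlgebra.of ℚ G) θ
      fun g => linExt_of _ _))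
  let μ := (linExt fun g => MonoidAlgebra.of ℚ G g - 1).comp s
  have hmem : ∀ t, μ t ∈ augIdeal G := fun t => by
    rw [mem_augIdeal, LinearMap.comp_apply, linExt_of_sub_one, map_sub, AlgHom.commutes]
    exact sub_self _
  have hθμ : ∀ t, θ (μ t) = t := by
    have h1 : θ.comp (linExt fun g => MonoidAlgebra.of ℚ G g - 1) = θ := by
      apply linearMap_ext_of
      intro g
      rw [LinearMap.comp_apply, linExt_of, map_sub, ← map_one (MonoidAlgebra.of ℚ G), linExt_of,
        linExt_of, map_one_of_additive abLog_mul, sub_zero]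
    intro t
    exact (LinearMap.congr_fun h1 (s t)).trans (LinearMap.congr_fun hs t)
  have hθσ : ∀ x, θ (algMap σ x) = malcevMap (abelianisationMap σ) (θ x) := by
    have h1 : θ.comp (algMap σ).toLinearMap = (malcevMap (abelianisationMap σ)).comp θ := by
      apply linearMap_ext_of
      intro g
      rw [LinearMap.comp_apply, LinearMap.comp_apply, AlgHom.toLinearMap_apply, algMap_of, linExt_of,
        linExt_of, malcevMap_abLog]
    exact fun x => LinearMap.congr_fun h1 x
  have hα : ∀ x ∈ augIdeal G, algMap σ x ∈ augIdeal G := fun x hx =>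
    (augmentation_algMap σ x).trans hx
  refine ⟨μ, fun t => ?_, fun x hx => ⟨θ x, ?_⟩, fun t => ?_⟩
  · rw [Submodule.pow_one]
    exact hmem t
  · rw [Submodule.pow_one] at hx
    refine mem_augIdeal_sq_of_linExt_abLog_eq_zero (sub_mem hx (hmem _)) ?_
    change θ _ = 0
    rw [map_sub, hθμ, sub_self]
  · refine mem_augIdeal_sq_of_linExt_abLog_eq_zero (sub_mem (hα _ (hmem _)) (hmem _)) ?_
    change θ _ = 0
    rw [map_sub, hθσ, hθμ, hθμ, sub_self]

/-- As `Iᵏ⁺¹ = Iᵏ I`, multiplication turns presentations of `Iᵏ/Iᵏ⁺¹` and `I/I²` into one of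
`Iᵏ⁺¹/Iᵏ⁺²`, on the tensor product. -/
theorem IsPowerPresentation.tensor {k : ℕ} {T T' : Type*} [AddCommGroup T] [Module ℚ T]
    [AddCommGroup T'] [Module ℚ T'] {h : Module.End ℚ T} {h' : Module.End ℚ T'}
    {μ : T →ₗ[ℚ] MonoidAlgebra ℚ G} {μ' : T' →ₗ[ℚ] MonoidAlgebra ℚ G}
    (H : IsPowerPresentation σ k h μ) (H' : IsPowerPresentation σ 1 h' μ') :
    IsPowerPresentation σ (k + 1) (TensorProduct.map h h')
      (TensorProduct.lift ((LinearMap.mul ℚ (MonoidAlgebra ℚ G)).compl₁₂ μ μ')) := by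
  have hlift : ∀ t t', TensorProduct.lift ((LinearMap.mul ℚ (MonoidAlgebra ℚ G)).compl₁₂ μ μ')
      (t ⊗ₜ t') = μ t * μ' t' := fun t t' => rfl
  refine ⟨fun t => ?_, fun x hx => ?_, fun t => ?_⟩
  · induction t using TensorProduct.induction_on with
    | zero => rw [map_zero]; exact zero_mem _
    | tmul t t' => exact mul_mem_augIdeal_pow (H.mem t) (H'.mem t')
    | add a b ha hb => rw [map_add]; exact add_mem ha hb
  · let K : Submodule ℚ (MonoidAlgebra ℚ G) := LinearMap.range
      (TensorProduct.lift ((LinearMap.mul ℚ (MonoidAlgebra ℚ G)).compl₁₂ μ μ')) ⊔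
        (augIdeal G ^ (k + 1 + 1)).restrictScalars ℚ
    have hK : x ∈ K := by
      refine augIdeal_pow_succ_le K k (fun y hy g => ?_) hx
      obtain ⟨t, ht⟩ := H.exists_sub_mem y hy
      have hg : MonoidAlgebra.of ℚ G g - 1 ∈ augIdeal G ^ 1 := by
        rw [Submodule.pow_one]
        exact of_sub_one_mem_augIdeal g
      obtain ⟨t', ht'⟩ := H'.exists_sub_mem _ hg
      have h1 : y * (MonoidAlgebra.of ℚ G g - 1) = μ t * μ' t' +
          (μ t * (MonoidAlgebra.of ℚ G g - 1 - μ' t') +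
            (y - μ t) * (MonoidAlgebra.of ℚ G g - 1)) := by
        noncomm_ring
      rw [h1]
      exact Submodule.add_mem_sup ⟨t ⊗ₜ t', rfl⟩
        (add_mem (mul_mem_augIdeal_pow (m := k) (n := 2) (H.mem t) ht') (mul_mem_augIdeal_pow ht hg))
    obtain ⟨_, ⟨t, rfl⟩, z, hz, hxz⟩ := Submodule.mem_sup.1 hK
    refine ⟨t, ?_⟩
    rw [← hxz, add_sub_cancel_left]
    exact hz
  · induction t using TensorProduct.induction_on with
    | zero => rw [map_zero, map_zero, map_zero, map_zero, sub_zero]; exact zero_mem _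
    | tmul t t' =>
      rw [TensorProduct.map_tmul, hlift, hlift, map_mul]
      have h1 : algMap σ (μ t) * algMap σ (μ' t') - μ (h t) * μ' (h' t') =
          (algMap σ (μ t) - μ (h t)) * algMap σ (μ' t') +
            μ (h t) * (algMap σ (μ' t') - μ' (h' t')) := by
        noncomm_ring
      rw [h1]
      exact add_mem
        (mul_mem_augIdeal_pow (H.comm t) (augIdeal_pow_le_comap σ 1 (H'.mem t')))
        (mul_mem_augIdeal_pow (m := k) (n := 2) (H.mem _) (H'.comm t'))
    | add a b ha hb =>
      rw [map_add, map_add, map_add, map_add, add_sub_add_comm]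
      exact add_mem ha hb

theorem exists_isPowerPresentation [Group.IsNilpotent G] (σ : G →* G)
    [Module.Finite ℚ (malcevLie (G ⧸ isolatedDerived G))]
    (hi : IsPiIntegral π (malcevMap (abelianisationMap σ))) (k : ℕ) :
    ∃ (T : Type u) (_ : AddCommGroup T) (_ : Module ℚ T) (h : Module.End ℚ T)
      (μ : T →ₗ[ℚ] MonoidAlgebra ℚ G), Module.Finite ℚ T ∧ IsPiIntegral π h ∧
        IsPowerPresentation σ (k + 1) h μ := by
  obtain ⟨μ₁, H₁⟩ := exists_isPowerPresentation_one σ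
  induction k with
  | zero => exact ⟨_, _, _, _, μ₁, inferInstance, hi, H₁⟩
  | succ k ih =>
    obtain ⟨T, _, _, h, μ, _, hT, H⟩ := ih
    exact ⟨_, _, _, _, _, inferInstance, hT.tensorMap hi, H.tensor H₁⟩

/-- A polynomial annihilating `h` maps `Iᵏ` to `Iᵏ⁺¹`. -/
theorem IsPowerPresentation.aeval_mem {k : ℕ} {T : Type*} [AddCommGroup T] [Module ℚ T]
    {h : Module.End ℚ T} {μ : T →ₗ[ℚ] MonoidAlgebra ℚ G} (H : IsPowerPresentation σ k h μ) {P : ℚ[X]}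
    (hP : aeval h P = 0) {x : MonoidAlgebra ℚ G} (hx : x ∈ augIdeal G ^ k) :
    aeval (algMap σ).toLinearMap P x ∈ augIdeal G ^ (k + 1) := by
  let q := (Ideal.Quotient.mkₐ ℚ (augIdeal G ^ (k + 1))).toLinearMap
  let α := (Ideal.quotientMapₐ (augIdeal G ^ (k + 1)) (algMap σ)
    (augIdeal_pow_le_comap σ (k + 1))).toLinearMap
  obtain ⟨t, ht⟩ := H.exists_sub_mem x hx
  have hxt : q x = q (μ t) := by
    rw [← sub_eq_zero, ← map_sub]
    exact Ideal.Quotient.eq_zero_iff_mem.2 ht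
  have h1 := aeval_comm_apply (L := q) (f := (algMap σ).toLinearMap) (g := α) (fun _ => rfl) P x
  have h2 := aeval_comm_apply (L := q.comp μ) (f := h) (g := α) (fun v => by
    refine Eq.symm ?_
    rw [← sub_eq_zero]
    change q (algMap σ (μ v)) - q (μ (h v)) = 0
    rw [← map_sub]
    exact Ideal.Quotient.eq_zero_iff_mem.2 (H.comm v)) P t
  rw [hP, LinearMap.zero_apply, map_zero] at h2
  refine Ideal.Quotient.eq_zero_iff_mem.1 (h1.trans ?_)
  rw [hxt]
  exact h2.symm

/-- The logarithm filters the rational Lie algebra by the powers of the augmentation ideal, with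
`π`-integral factors. -/
theorem isPiLike_of_abelianisationMap [Group.IsNilpotent G] {c : ℕ} (hc : lcs G c = ⊥)
    (h : IsPiLike π (abelianisationMap σ)) : IsPiLike π σ := by
  rw [isPiLike_iff] at *
  obtain ⟨_, hi⟩ := h
  have key : ∀ j k, j + k = c →
      Module.Finite ℚ (((augIdeal G ^ (k + 1)).restrictScalars ℚ).map (logLie G)) ∧
      ∃ P : ℚ[X], (P.Monic ∧ (∀ k, P.coeff k ∈ zInvPi π) ∧ P.coeff 0 ≠ 0) ∧
        ∀ x ∈ augIdeal G ^ (k + 1), aeval (malcevMap σ) P (logLie G x) = 0 := by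
    intro j
    induction j with
    | zero =>
      intro k hk
      rw [zero_add] at hk
      subst hk
      have h0 : ((augIdeal G ^ (k + 1)).restrictScalars ℚ).map (logLie G) = ⊥ := by
        rw [eq_bot_iff]
        rintro _ ⟨x, hx, rfl⟩
        exact logLie_eq_zero hc hx
      refine ⟨h0 ▸ inferInstance, 1, ⟨monic_one, fun k => ?_, by simp⟩, fun x hx => ?_⟩
      · rw [coeff_one]
        split_ifs
        exacts [(piRing π).one_mem, (piRing π).zero_mem]
      · rw [logLie_eq_zero hc hx, map_zero]
    | succ j ih =>
      intro k hk
      obtain ⟨hfin, P, hP, hPk⟩ := ih (k + 1) (by omega)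
      obtain ⟨T, _, _, f, μ, _, ⟨Q, hQ, hQf⟩, H⟩ := exists_isPowerPresentation σ hi k
      constructor
      · have hle : ((augIdeal G ^ (k + 1)).restrictScalars ℚ).map (logLie G) ≤
            LinearMap.range ((logLie G).comp μ) ⊔
              ((augIdeal G ^ (k + 1 + 1)).restrictScalars ℚ).map (logLie G) := by
          rintro _ ⟨x, hx, rfl⟩
          obtain ⟨t, ht⟩ := H.exists_sub_mem x hx
          rw [← add_sub_cancel (μ t) x, map_add]
          exact Submodule.add_mem_sup ⟨t, rfl⟩ ⟨_, ht, rfl⟩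
        exact Submodule.finiteDimensional_of_le hle
      · refine ⟨P * Q, piPolynomial_mul hP hQ, fun x hx => ?_⟩
        rw [map_mul, Module.End.mul_apply,
          ← aeval_comm_apply (L := logLie G) (f := (algMap σ).toLinearMap) (g := malcevMap σ)
            (fun x => (malcevMap_logLie σ x).symm) Q x]
        exact hPk _ (H.aeval_mem hQf hx)
  obtain ⟨hfin, P, hP, hPk⟩ := key c 0 rfl
  -- constants have logarithm zero, so `I` already has the whole Lie algebra as its image
  have hsurj : ∀ v : malcevLie G, ∃ x ∈ augIdeal G ^ (0 + 1), logLie G x = v := by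
    intro v
    obtain ⟨x, rfl⟩ := logLie_surjective v
    refine ⟨x - algebraMap ℚ _ (augmentation G x), ?_, ?_⟩
    · rw [zero_add, Submodule.pow_one, mem_augIdeal, map_sub, AlgHom.commutes]
      exact sub_self _
    · rw [map_sub, Algebra.algebraMap_eq_smul_one, map_smul, ← map_one (MonoidAlgebra.of ℚ G),
        logLie_of, show lieLog (1 : G) = 0 from Subtype.ext log_one, smul_zero, sub_zero]
  refine ⟨?_, P, hP, LinearMap.ext fun v => ?_⟩
  · have htop : ((augIdeal G ^ (0 + 1)).restrictScalars ℚ).map (logLie G) = ⊤ := by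
      rw [eq_top_iff]
      intro v _
      exact hsurj v
    rw [htop] at hfin
    exact Module.Finite.equiv Submodule.topEquiv
  · obtain ⟨x, hx, rfl⟩ := hsurj v
    exact hPk x hx

end AugmentationPowers

end PiLike

end

theorem proposition3p4 (π : Set Nat.Primes) {N : Type*} [Group N] [Group.IsNilpotent N]
    (htf : PiLike.TorsionFree N) (hrank : PiLike.FiniteRank N)
    (σ : N →* N) (hσ : Function.Injective σ) :
    List.TFAE [
      PiLike.IsPiLike π σ,
      ∀ S : PiLike.InvariantCentralSeries σ, ∀ i : ℕ, PiLike.IsPiLike π (S.secMap i),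
      PiLike.IsPiLike π (PiLike.abelianisationMap σ)] := by
  obtain ⟨c, hc⟩ := PiLike.exists_isoLcs_succ_eq_bot htf
  tfae_have 1 → 3 := PiLike.isPiLike_abelianisationMap_of_isPiLike σ
  tfae_have 3 → 1 := fun h => by
    obtain ⟨n, hn⟩ := Subgroup.nilpotent_iff_lowerCentralSeries.1 ‹Group.IsNilpotent N›
    exact PiLike.isPiLike_of_abelianisationMap hn h
  tfae_have 2 → 3 := fun h => PiLike.isPiLike_abelianisationMap_of_isoSeries σ c hc (h _ c)
  tfae_have 3 → 2 := fun h S i => PiLike.isPiLike_iff.2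
    ⟨PiLike.finite_of_finiteRank hrank (S.secLog_mul i) (S.span_range_secLog i),
      PiLike.isPiIntegral_secMap_of_forall (PiLike.isoSeries σ (c + 1) hc) S
        (fun k hk => PiLike.isPiIntegral_isoSeries σ c hc (PiLike.isPiLike_iff.1 h).2 (c - k) k (by
          have : k < c + 1 := hk
          omega)) i⟩
  tfae_finish
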